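/- **Theorem 1.1.** There is a Turing ideal $\mathcal I\subseteq\mathcal P(\omega)$ such that the $\omega$-model $(\omega,\mathcal I)$ satisfies $\mathsf{ADS}$ but not $\mathsf{SCAC}$. Therefore $\mathsf{ADS}$ does not imply $\mathsf{SCAC}$ over $\mathsf{RCA}_0$, and so $\mathsf{ADS}$ does not imply $\mathsf{CAC}$ over $\mathsf{RCA}_0$. Here a Turing ideal is a nonempty collection of subsets of $\omega$ that is closed downwards under Turing reducibility and closed under the join $A\oplus B=\{2n: n\in A\}\cup\{2n+1: n\in B\}$. The $\omega$-model $(\omega,\mathcal I)$ is the structure for second-order arithmetic with the standard natural numbers as numbers and the members of $\mathcal I$ as sets. All orders have domain $\mathbb N$, and relations and functions are coded as sets of pairs. In second-order arithmetic: * $\mathsf{ADS}$ states that for every linear order $<_L$ of $\mathbb N$ there is a function $f:\mathbb N\to\mathbb N$ such that either $f(n)<_L f(m)$ for all $n<m$, or $f(m)<_L f(n)$ for all $n<m$. * $\mathsf{CAC}$ states that every partial order $M=(\mathbb N,\preceq_M)$ has an infinite chain or an infinite antichain. * $\mathsf{SCAC}$ states the same for every stable partial order $M=(\mathbb N,\preceq_M)$.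 Here $M$ is stable if every $n$ lies in $A^*(M)\cup B^*(M)$ or every $n$ lies in $C^*(M)\cup B^*(M)$, where $A^*(M)$, $B^*(M)$ and $C^*(M)$ are the sets of those $n$ for which there is an $x$ such that for all $y>x$, respectively, $n\preceq_M y$; $n$ and $y$ are incomparable; $y\preceq_M n$. A principle $P$ implies a principle $Q$ over $\mathsf{RCA}_0$ if every model (with possibly nonstandard numbers) of $\mathsf{RCA}_0+P$ satisfies $Q$; equivalently, if $\mathsf{RCA}_0+P$ proves $Q$. -/

import Mathlib

/-! ### Structures for the language of second-order arithmetic -/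

/-- A structure for the two-sorted language `L₂` of second-order arithmetic: a number sort with
`0, 1, +, ·, <` and a collection `sets` of subsets of the number sort, over which the set
variables range. (Restricting carriers to `Type` loses nothing, the language being countable.) -/
structure L2Structure where
  carrier : Type
  [instZero : Zero carrier]
  [instOne : One carrier]
  [instAdd : Add carrier]
  [instMul : Mul carrier]
  [instLT : LT carrier]
  sets : Set (Set carrier)

attribute [instance] L2Structure.instZero L2Structure.instOne L2Structure.instAdd
  L2Structure.instMul L2Structure.instLT

/-- The `ω`-model `(ω, I)`: its numbers are the standard natural numbers with their usual
arithmetic and order, its sets are the members of `I`. -/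
abbrev omegaModel (I : Set (Set ℕ)) : L2Structure where
  carrier := ℕ
  sets := I

/-! ### Turing ideals -/

/-- The characteristic function of a set of natural numbers, as a (total) partial function. -/
noncomputable def charFun (A : Set ℕ) : ℕ →. ℕ :=
  open Classical in fun n => Part.some (if n ∈ A then 1 else 0)

/-- Turing reducibility `A ≤_T B` between sets of natural numbers. -/
def SetTuringReducible (A B : Set ℕ) : Prop :=
  TuringReducible (charFun A) (charFun B)

/-- The effective join `A ⊕ B = {2n | n ∈ A} ∪ {2n + 1 | n ∈ B}`. -/
def turingJoin (A B : Set ℕ) : Set ℕ :=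
  {x | (∃ n ∈ A, x = 2 * n) ∨ ∃ n ∈ B, x = 2 * n + 1}

/-- A Turing ideal: a nonempty collection of sets of natural numbers which is closed downwards
under Turing reducibility and closed under effective join. -/
structure IsTuringIdeal (I : Set (Set ℕ)) : Prop where
  nonempty : I.Nonempty
  downward : ∀ A B : Set ℕ, B ∈ I → SetTuringReducible A B → A ∈ I
  join : ∀ A B : Set ℕ, A ∈ I → B ∈ I → turingJoin A B ∈ I

/-! ### Bounded quantifier formulas and `RCA₀` -/

/-- Numerical terms of `L₂` in `n` number variables. -/
inductive L2Term (n : ℕ) : Type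
  | var (i : Fin n) : L2Term n
  | zero : L2Term n
  | one : L2Term n
  | add (s t : L2Term n) : L2Term n
  | mul (s t : L2Term n) : L2Term n

/-- Bounded quantifier formulas of `L₂` in `k` set variables and `n` number variables. In
`ball t φ`, which is `∀ x < t, φ`, the new variable `x` has index `0` in `φ`, and `t` does not
contain it. The other connectives and the bounded existential quantifier are definable. -/
inductive BddFormula (k : ℕ) : ℕ → Type
  | eq {n : ℕ} (s t : L2Term n) : BddFormula k n
  | lt {n : ℕ} (s t : L2Term n) : BddFormula k n
  | mem {n : ℕ} (t : L2Term n) (X : Fin k) : BddFormula k n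
  | not {n : ℕ} (φ : BddFormula k n) : BddFormula k n
  | and {n : ℕ} (φ ψ : BddFormula k n) : BddFormula k n
  | ball {n : ℕ} (t : L2Term n) (φ : BddFormula k (n + 1)) : BddFormula k n

/-- The value of a term under an assignment `e` of the number variables. -/
def L2Term.eval {n : ℕ} {M : Type} [Zero M] [One M] [Add M] [Mul M] (e : Fin n → M) :
    L2Term n → M
  | .var i => e i
  | .zero => 0
  | .one => 1
  | .add s t => s.eval e + t.eval e
  | .mul s t => s.eval e * t.eval e

/-- Truth of a bounded quantifier formula under assignments `S` of the set variables and `e` of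
the number variables. -/
def BddFormula.Realize {k : ℕ} {M : Type} [Zero M] [One M] [Add M] [Mul M] [LT M]
    (S : Fin k → Set M) : {n : ℕ} → BddFormula k n → (Fin n → M) → Prop
  | _, .eq s t, e => s.eval e = t.eval e
  | _, .lt s t, e => s.eval e < t.eval e
  | _, .mem t X, e => t.eval e ∈ S X
  | _, .not φ, e => ¬ φ.Realize S e
  | _, .and φ ψ, e => φ.Realize S e ∧ ψ.Realize S e
  | _, .ball t φ, e => ∀ a : M, a < t.eval e → φ.Realize S (Fin.cons a e)

namespace L2Structure

variable (𝓜 : L2Structure)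

/-- `P(n)` is defined in `𝓜` by a `Σ⁰₁` formula `∃ m, θ(m, n)`, with `θ` a bounded quantifier
formula that may have number and set parameters from `𝓜`. -/
def IsSigma01 (P : 𝓜.carrier → Prop) : Prop :=
  ∃ (k p : ℕ) (θ : BddFormula k (p + 2)) (S : Fin k → Set 𝓜.carrier) (e : Fin p → 𝓜.carrier),
    (∀ i, S i ∈ 𝓜.sets) ∧
      ∀ n, P n ↔ ∃ m, θ.Realize S (Fin.cons m (Fin.cons n e : Fin (p + 1) → 𝓜.carrier))

/-- `P(n)` is defined in `𝓜` by a `Π⁰₁` formula `∀ m, θ(m, n)`, with `θ` a bounded quantifier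
formula that may have number and set parameters from `𝓜`. -/
def IsPi01 (P : 𝓜.carrier → Prop) : Prop :=
  ∃ (k p : ℕ) (θ : BddFormula k (p + 2)) (S : Fin k → Set 𝓜.carrier) (e : Fin p → 𝓜.carrier),
    (∀ i, S i ∈ 𝓜.sets) ∧
      ∀ n, P n ↔ ∀ m, θ.Realize S (Fin.cons m (Fin.cons n e : Fin (p + 1) → 𝓜.carrier))

/-- `𝓜` is a model of `RCA₀`: the basic axioms of arithmetic, the `Σ⁰₁` induction scheme and the
`Δ⁰₁` comprehension scheme. -/
structure ModelsRCA0 : Prop where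
  succ_ne_zero : ∀ n : 𝓜.carrier, n + 1 ≠ 0
  succ_inj : ∀ m n : 𝓜.carrier, m + 1 = n + 1 → m = n
  add_zero : ∀ m : 𝓜.carrier, m + 0 = m
  add_succ : ∀ m n : 𝓜.carrier, m + (n + 1) = (m + n) + 1
  mul_zero : ∀ m : 𝓜.carrier, m * 0 = 0
  mul_succ : ∀ m n : 𝓜.carrier, m * (n + 1) = m * n + m
  not_lt_zero : ∀ m : 𝓜.carrier, ¬ m < 0
  lt_succ : ∀ m n : 𝓜.carrier, m < n + 1 ↔ m < n ∨ m = n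
  sigma_induction : ∀ P : 𝓜.carrier → Prop, 𝓜.IsSigma01 P →
    P 0 → (∀ n, P n → P (n + 1)) → ∀ n, P n
  delta_comprehension : ∀ P : 𝓜.carrier → Prop, 𝓜.IsSigma01 P → 𝓜.IsPi01 P →
    {n | P n} ∈ 𝓜.sets

/-! ### Relations, functions, orders inside a structure -/

variable {𝓜}

/-- The usual pairing of second-order arithmetic, `(a, b) = (a + b)² + a`. -/
def pair (a b : 𝓜.carrier) : 𝓜.carrier := (a + b) * (a + b) + a

/-- The binary relation on the numbers of `𝓜` that is coded by the set `X`. -/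
def Rel (X : Set 𝓜.carrier) (a b : 𝓜.carrier) : Prop := pair a b ∈ X

/-- `X` is unbounded in the numbers of `𝓜`, that is, infinite in the sense of `𝓜`. -/
def IsInfinite (X : Set 𝓜.carrier) : Prop := ∀ x : 𝓜.carrier, ∃ y ∈ X, x < y

/-- `F` codes a function from numbers to numbers. -/
def IsFunction (F : Set 𝓜.carrier) : Prop := ∀ n : 𝓜.carrier, ∃! a, Rel F n a

/-- `L` codes a (strict) linear order `<_L` of the numbers. -/
def IsLinearOrder (L : Set 𝓜.carrier) : Prop :=
  (∀ a, ¬ Rel L a a) ∧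
  (∀ a b c, Rel L a b → Rel L b c → Rel L a c) ∧
  (∀ a b, Rel L a b ∨ a = b ∨ Rel L b a)

/-- `F` codes an infinite ascending sequence in the linear order coded by `L`. -/
def IsAscendingSeq (L F : Set 𝓜.carrier) : Prop :=
  IsFunction F ∧ ∀ n m a b : 𝓜.carrier, n < m → Rel F n a → Rel F m b → Rel L a b

/-- `F` codes an infinite descending sequence in the linear order coded by `L`. -/
def IsDescendingSeq (L F : Set 𝓜.carrier) : Prop :=
  IsFunction F ∧ ∀ n m a b : 𝓜.carrier, n < m → Rel F n a → Rel F m b → Rel L b a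

/-- `X` codes a (reflexive) partial order `≼` of the numbers. -/
def IsPoset (X : Set 𝓜.carrier) : Prop :=
  (∀ a, Rel X a a) ∧
  (∀ a b, Rel X a b → Rel X b a → a = b) ∧
  (∀ a b c, Rel X a b → Rel X b c → Rel X a c)

/-- `a` and `b` are comparable in the partial order coded by `X`. -/
def Comparable (X : Set 𝓜.carrier) (a b : 𝓜.carrier) : Prop := Rel X a b ∨ Rel X b a

/-- `C` is a chain in the partial order coded by `X`. -/
def IsChainIn (X C : Set 𝓜.carrier) : Prop := ∀ a ∈ C, ∀ b ∈ C, Comparable X a b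

/-- `C` is an antichain in the partial order coded by `X`. -/
def IsAntichainIn (X C : Set 𝓜.carrier) : Prop :=
  ∀ a ∈ C, ∀ b ∈ C, a ≠ b → ¬ Comparable X a b

/-- `A*`: the elements that are below almost every element. -/
def AStar (X : Set 𝓜.carrier) : Set 𝓜.carrier := {n | ∃ x, ∀ y, x < y → Rel X n y}

/-- `B*`: the elements that are incomparable with almost every element. -/
def BStar (X : Set 𝓜.carrier) : Set 𝓜.carrier := {n | ∃ x, ∀ y, x < y → ¬ Comparable X n y}

/-- `C*`: the elements that are above almost every element. -/
def CStar (X : Set 𝓜.carrier) : Set 𝓜.carrier := {n | ∃ x, ∀ y, x < y → Rel X y n}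

/-- The partial order coded by `X` is stable. -/
def IsStable (X : Set 𝓜.carrier) : Prop :=
  AStar X ∪ BStar X = Set.univ ∨ CStar X ∪ BStar X = Set.univ

/-! ### The principles

Each is an `L₂` sentence, given by its truth in a structure `𝓜`: set quantifiers range over
`𝓜.sets` and number quantifiers over `𝓜.carrier`. -/

variable (𝓜)

/-- `𝓜 ⊨ ADS`: every linear order has an infinite ascending or infinite descending sequence. -/
def ADS : Prop :=
  ∀ L ∈ 𝓜.sets, IsLinearOrder L → ∃ F ∈ 𝓜.sets, IsAscendingSeq L F ∨ IsDescendingSeq L F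

/-- `𝓜 ⊨ CAC`: every partial order has an infinite chain or an infinite antichain. -/
def CAC : Prop :=
  ∀ X ∈ 𝓜.sets, IsPoset X → ∃ C ∈ 𝓜.sets, IsInfinite C ∧ (IsChainIn X C ∨ IsAntichainIn X C)

/-- `𝓜 ⊨ SCAC`: every stable partial order has an infinite chain or an infinite antichain. -/
def SCAC : Prop :=
  ∀ X ∈ 𝓜.sets, IsPoset X → IsStable X →
    ∃ C ∈ 𝓜.sets, IsInfinite C ∧ (IsChainIn X C ∨ IsAntichainIn X C)

end L2Structure

/-- `φ` implies `ψ` over `RCA₀`: every model of `RCA₀ + φ` is a model of `ψ`. Structures with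
nonstandard numbers are included, so for `L₂` sentences this is the same as provability of `ψ` in
`RCA₀ + φ`. -/
def ImpliesOverRCA0 (φ ψ : L2Structure → Prop) : Prop :=
  ∀ 𝓜 : L2Structure, 𝓜.ModelsRCA0 → φ 𝓜 → ψ 𝓜

/-! The counterexample to `SCAC` is a partial order contained in the usual order of `ℕ`, in which
each element is below almost all elements (these form the set `A`) or incomparable with almost all
of them. An element of an infinite chain is comparable with infinitely many elements, so infinite
chains lie in `A` and infinite antichains in `Aᶜ`. It remains to find an ideal that contains the
order, satisfies `ADS`, and has no infinite member inside `A` or `Aᶜ`.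

The invariant behind this is `DepHyperimmune`: every essential relation enumerated from the current
oracle holds at some `(R, S)` with `R ⊆ A` and `S ⊆ Aᶜ`. It excludes infinite subsets of `A` and of
`Aᶜ` (`DepHyperimmune.not_infinite_subset`). It can be forced by finite pieces of the order, because
an essential relation offers `R` first and then `S` beyond any bound: new elements up to a bound
past `R` are promised to `A`, and later ones, including `S`, to `Aᶜ` (`exists_extension_forces`).

The invariant survives solving one linear order (`DepHyperimmune.exists_monotone_seq`). An ascending
`f` and a descending `g` are built together, with infinitely many elements left between them. Given
a relation for each, their amalgam consists of the pairs below which both relations hold along some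
pair of extensions. If both relations end up essential, so is the amalgam (`Essential.amalg`), and
the invariant supplies a pair split by `A`. The corresponding two extensions cannot in general be
made together, but one of them leaves an infinite interval, and making it settles the relation on
that side. Treating all pairs of relations in this way, `f` or `g` preserves the invariant.
Iterating over all linear orders that appear gives the ideal.

Sets enter through their positive and negative facts, which turns Turing reductions into
enumerations. The forcing uses only that the operators are continuous, countably many and closed
under the constructions of `OpCode`; their computability plays no role. -/

/-! ### Finitary properties and enumeration operators -/

/-- A property of sets is finitary if it holds of a set exactly when it holds of some finite
subset. -/
def Finitary (P : Set ℕ → Prop) : Prop :=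
  ∀ O, P O ↔ ∃ F : Finset ℕ, (F : Set ℕ) ⊆ O ∧ P F

namespace Finitary

variable {P Q : Set ℕ → Prop}

theorem mono (h : Finitary P) {O O' : Set ℕ} (hO : O ⊆ O') (hP : P O) : P O' := by
  obtain ⟨F, hF, hPF⟩ := (h O).1 hP
  exact (h O').2 ⟨F, hF.trans hO, hPF⟩

theorem of_mono (hm : ∀ O O', O ⊆ O' → P O → P O')
    (hf : ∀ O, P O → ∃ F : Finset ℕ, (F : Set ℕ) ⊆ O ∧ P F) : Finitary P :=
  fun O => ⟨hf O, fun ⟨_, hF, hP⟩ => hm _ _ hF hP⟩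

theorem const (p : Prop) : Finitary fun _ => p :=
  of_mono (fun _ _ _ h => h) fun _ h => ⟨∅, by simp, h⟩

theorem mem (n : ℕ) : Finitary fun O => n ∈ O :=
  of_mono (fun _ _ h hn => h hn) fun _ h => ⟨{n}, by simpa using h, by simp⟩

theorem and (hP : Finitary P) (hQ : Finitary Q) : Finitary fun O => P O ∧ Q O :=
  of_mono (fun _ _ h hPQ => ⟨hP.mono h hPQ.1, hQ.mono h hPQ.2⟩) fun O hPQ => by
    obtain ⟨F, hF, hPF⟩ := (hP O).1 hPQ.1
    obtain ⟨G, hG, hQG⟩ := (hQ O).1 hPQ.2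
    exact ⟨F ∪ G, by simp [hF, hG], hP.mono (by simp) hPF, hQ.mono (by simp) hQG⟩

theorem or (hP : Finitary P) (hQ : Finitary Q) : Finitary fun O => P O ∨ Q O :=
  of_mono (fun _ _ h => Or.imp (hP.mono h) (hQ.mono h)) fun O hPQ => by
    rcases hPQ with h | h
    · obtain ⟨F, hF, hPF⟩ := (hP O).1 h
      exact ⟨F, hF, Or.inl hPF⟩
    · obtain ⟨F, hF, hPF⟩ := (hQ O).1 h
      exact ⟨F, hF, Or.inr hPF⟩

theorem ex {ι : Sort*} {P : ι → Set ℕ → Prop} (h : ∀ i, Finitary (P i)) :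
    Finitary fun O => ∃ i, P i O :=
  of_mono (fun _ _ hO ⟨i, hi⟩ => ⟨i, (h i).mono hO hi⟩) fun O ⟨i, hi⟩ => by
    obtain ⟨F, hF, hPF⟩ := (h i O).1 hi
    exact ⟨F, hF, i, hPF⟩

theorem forall_lt {P : ℕ → Set ℕ → Prop} (h : ∀ i, Finitary (P i)) (n : ℕ) :
    Finitary fun O => ∀ i, i < n → P i O := by
  induction n with
  | zero => simpa using const True
  | succ n ih =>
    have := ih.and (h n)
    simpa only [Nat.lt_succ_iff_lt_or_eq, or_imp, forall_and, forall_eq] using this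

theorem forall_mem {α : Type*} {P : α → Set ℕ → Prop} (h : ∀ a, Finitary (P a)) (l : List α) :
    Finitary fun O => ∀ a ∈ l, P a O := by
  induction l with
  | nil => simpa using const True
  | cons a l ih => simpa using (h a).and ih

theorem pairwise {α : Type*} {P : α → α → Set ℕ → Prop} (h : ∀ a b, Finitary (P a b))
    (l : List α) : Finitary fun O => l.Pairwise fun a b => P a b O := by
  induction l with
  | nil => simpa using const True
  | cons a l ih => simpa using (forall_mem (h a) l).and ih

end Finitary

/-- An enumeration operator, that is, a Scott continuous map of `Set ℕ` to itself. -/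
def IsEnumOp (Φ : Set ℕ → Set ℕ) : Prop := ∀ n, Finitary fun O => n ∈ Φ O

theorem IsEnumOp.mono {Φ : Set ℕ → Set ℕ} (h : IsEnumOp Φ) {O O' : Set ℕ} (hO : O ⊆ O') :
    Φ O ⊆ Φ O' := fun n hn => (h n).mono hO hn

/-- A finite witness for `P` inside `Φ O` has finitely many elements, each needing only finitely
much of `O`; by monotonicity the union of these parts serves all of them. -/
theorem Finitary.comp {P : Set ℕ → Prop} (hP : Finitary P) {Φ : Set ℕ → Set ℕ}
    (hΦ : IsEnumOp Φ) : Finitary fun O => P (Φ O) :=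
  .of_mono (fun _ _ h => hP.mono (hΦ.mono h)) fun O h => by
    obtain ⟨F, hF, hPF⟩ := (hP _).1 h
    obtain ⟨G, hG, hFG⟩ : ∃ G : Finset ℕ, (G : Set ℕ) ⊆ O ∧ (F : Set ℕ) ⊆ Φ G := by
      clear h hPF
      induction F using Finset.induction with
      | empty => exact ⟨∅, by simp⟩
      | insert a F _ ih =>
        rw [Finset.coe_insert, Set.insert_subset_iff] at hF
        obtain ⟨G, hG, hFG⟩ := ih hF.2
        obtain ⟨G', hG', ha⟩ := (hΦ a O).1 hF.1
        refine ⟨G ∪ G', by simp [hG, hG'], ?_⟩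
        rw [Finset.coe_insert, Set.insert_subset_iff]
        exact ⟨hΦ.mono (by simp) ha, hFG.trans (hΦ.mono (by simp))⟩
    exact ⟨G, hG, hP.mono hFG hPF⟩

/-! ### Joins and total sets of facts -/

@[simp] theorem two_mul_mem_turingJoin {A B : Set ℕ} {n : ℕ} : 2 * n ∈ turingJoin A B ↔ n ∈ A := by
  constructor
  · rintro (⟨m, hm, h⟩ | ⟨m, hm, h⟩)
    · rwa [show n = m by lia]
    · lia
  · exact fun h => Or.inl ⟨n, h, rfl⟩

@[simp] theorem two_mul_add_one_mem_turingJoin {A B : Set ℕ} {n : ℕ} :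
    2 * n + 1 ∈ turingJoin A B ↔ n ∈ B := by
  constructor
  · rintro (⟨m, hm, h⟩ | ⟨m, hm, h⟩)
    · lia
    · rwa [show n = m by lia]
  · exact fun h => Or.inr ⟨n, h, rfl⟩

theorem forall_nat_parity {p : ℕ → Prop} : (∀ n, p n) ↔ ∀ n, p (2 * n) ∧ p (2 * n + 1) := by
  refine ⟨fun h n => ⟨h _, h _⟩, fun h n => ?_⟩
  obtain ⟨m, rfl | rfl⟩ := Nat.even_or_odd' n
  exacts [(h m).1, (h m).2]

theorem eq_turingJoin_iff {A B C : Set ℕ} :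
    C = turingJoin A B ↔ ∀ n, (2 * n ∈ C ↔ n ∈ A) ∧ (2 * n + 1 ∈ C ↔ n ∈ B) := by
  rw [Set.ext_iff, forall_nat_parity]
  simp

theorem turingJoin_mono {A A' B B' : Set ℕ} (hA : A ⊆ A') (hB : B ⊆ B') :
    turingJoin A B ⊆ turingJoin A' B' := by
  rintro x (⟨n, hn, rfl⟩ | ⟨n, hn, rfl⟩)
  · simpa using hA hn
  · simpa using hB hn

theorem IsEnumOp.turingJoin {Φ Ψ : Set ℕ → Set ℕ} (hΦ : IsEnumOp Φ) (hΨ : IsEnumOp Ψ) :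
    IsEnumOp fun O => turingJoin (Φ O) (Ψ O) := by
  refine forall_nat_parity.2 fun n => ⟨?_, ?_⟩
  · simpa using hΦ n
  · simpa using hΨ n

theorem IsEnumOp.const (A : Set ℕ) : IsEnumOp fun _ => A := fun _ => .const _

theorem IsEnumOp.id : IsEnumOp fun O => O := fun n => .mem n

theorem IsEnumOp.comp {Φ Ψ : Set ℕ → Set ℕ} (hΦ : IsEnumOp Φ) (hΨ : IsEnumOp Ψ) :
    IsEnumOp fun O => Φ (Ψ O) := fun n => (hΦ n).comp hΨ

/-- The positive and negative membership facts of a set. -/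
def facts (Y : Set ℕ) : Set ℕ := turingJoin Y Yᶜ

@[simp] theorem two_mul_mem_facts {Y : Set ℕ} {n : ℕ} : 2 * n ∈ facts Y ↔ n ∈ Y := by
  simp [facts]

@[simp] theorem two_mul_add_one_mem_facts {Y : Set ℕ} {n : ℕ} : 2 * n + 1 ∈ facts Y ↔ n ∉ Y := by
  simp [facts]

/-- Facts are preserved under passing to a set that agrees below a bound. -/
theorem mem_facts_congr {Y Y' : Set ℕ} {n N : ℕ} (hn : n < N)
    (h : ∀ j < N, (j ∈ Y ↔ j ∈ Y')) : n ∈ facts Y ↔ n ∈ facts Y' := by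
  obtain ⟨m, rfl | rfl⟩ := Nat.even_or_odd' n
  · simpa using h m (by lia)
  · simpa using not_congr (h m (by lia))

/-! ### Oracle computations -/

/-- Codes for partial recursive functionals. -/
inductive OracleCode : Type
  | zero
  | succ
  | left
  | right
  | oracle
  | pair (a b : OracleCode)
  | comp (a b : OracleCode)
  | prec (a b : OracleCode)
  | rfind (a : OracleCode)
deriving Countable

/-- The relation `R` iterated along primitive recursion with initial values `B`. -/
def PrecRel (B : ℕ → Prop) (R : ℕ → ℕ → ℕ → Prop) : ℕ → ℕ → Prop
  | 0, v => B v
  | n + 1, v => ∃ i, PrecRel B R n i ∧ R n i v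

/-- The graph of a partial recursive functional with oracle answers given by a set of facts. -/
def OracleCode.Graph (O : Set ℕ) : OracleCode → ℕ → ℕ → Prop
  | zero, _, v => v = 0
  | succ, n, v => v = n + 1
  | left, n, v => v = n.unpair.1
  | right, n, v => v = n.unpair.2
  | oracle, n, v => (v = 1 ∧ 2 * n ∈ O) ∨ (v = 0 ∧ 2 * n + 1 ∈ O)
  | pair a b, n, v => ∃ x y, (a.Graph O n x ∧ b.Graph O n y) ∧ v = Nat.pair x y
  | comp a b, n, v => ∃ x, b.Graph O n x ∧ a.Graph O x v
  | prec a b, n, v => PrecRel (a.Graph O n.unpair.1)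
      (fun y i w => b.Graph O (Nat.pair n.unpair.1 (Nat.pair y i)) w) n.unpair.2 v
  -- Earlier values must exist and be nonzero. This is positive information, so minimization remains
  -- finitary in `O`.
  | rfind a, n, v => a.Graph O (Nat.pair n v) 0 ∧
      ∀ k, k < v → ∃ w, w ≠ 0 ∧ a.Graph O (Nat.pair n k) w

theorem Finitary.precRel {B : Set ℕ → ℕ → Prop} {R : Set ℕ → ℕ → ℕ → ℕ → Prop}
    (hB : ∀ v, Finitary fun O => B O v) (hR : ∀ n i v, Finitary fun O => R O n i v) (n v : ℕ) :
    Finitary fun O => PrecRel (B O) (R O) n v := by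
  induction n generalizing v with
  | zero => exact hB v
  | succ n ih => exact .ex fun i => (ih i).and (hR n i v)

theorem OracleCode.finitary_graph (c : OracleCode) (n v : ℕ) :
    Finitary fun O => c.Graph O n v := by
  induction c generalizing n v with
  | zero | succ | left | right => exact .const _
  | oracle => exact ((Finitary.const _).and (.mem _)).or ((Finitary.const _).and (.mem _))
  | pair a b iha ihb =>
    exact .ex fun x => .ex fun y => ((iha n x).and (ihb n y)).and (.const _)
  | comp a b iha ihb => exact .ex fun x => (ihb n x).and (iha x v)
  | prec a b iha ihb => exact .precRel (iha _) (fun _ _ => ihb _) _ _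
  | rfind a ih =>
    exact (ih _ _).and (.forall_lt (fun k => .ex fun w => (Finitary.const _).and (ih _ w)) v)

theorem exists_oracleCode {Y : Set ℕ} {f : ℕ →. ℕ} (hf : Nat.RecursiveIn {charFun Y} f) :
    ∃ c : OracleCode, ∀ n v, c.Graph (facts Y) n v ↔ v ∈ f n := by
  induction hf with
  | zero => exact ⟨.zero, fun n v => by simp [OracleCode.Graph, Part.zero_def]⟩
  | succ => exact ⟨.succ, fun n v => by simp [OracleCode.Graph]⟩
  | left => exact ⟨.left, fun n v => by simp [OracleCode.Graph]⟩
  | right => exact ⟨.right, fun n v => by simp [OracleCode.Graph]⟩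
  | oracle g hg =>
    refine ⟨.oracle, fun n v => ?_⟩
    obtain rfl : g = charFun Y := hg
    by_cases h : n ∈ Y <;> simp [OracleCode.Graph, charFun, h]
  | pair _ _ iha ihb =>
    obtain ⟨a, ha⟩ := iha
    obtain ⟨b, hb⟩ := ihb
    refine ⟨.pair a b, fun n v => ?_⟩
    simp [OracleCode.Graph, ha, hb, Seq.seq, and_assoc, eq_comm]
  | comp _ _ iha ihb =>
    obtain ⟨a, ha⟩ := iha
    obtain ⟨b, hb⟩ := ihb
    exact ⟨.comp a b, fun n v =>
      (exists_congr fun x => and_congr (hb n x) (ha x v)).trans Part.mem_bind_iff.symm⟩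
  | prec _ _ iha ihb =>
    obtain ⟨a, ha⟩ := iha
    obtain ⟨b, hb⟩ := ihb
    refine ⟨.prec a b, fun n v => ?_⟩
    simp only [OracleCode.Graph]
    generalize n.unpair.2 = m
    induction m generalizing v with
    | zero => simp [PrecRel, ha]
    | succ m ih =>
      exact (exists_congr fun i => and_congr (ih i) (hb _ v)).trans Part.mem_bind_iff.symm
  | rfind _ ih =>
    obtain ⟨a, ha⟩ := ih
    refine ⟨.rfind a, fun n v => ?_⟩
    refine (and_congr (ha _ _) (forall₂_congr fun k _ =>
      exists_congr fun w => and_congr_right' (ha _ _))).trans (Iff.trans ?_ Nat.mem_rfind.symm)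
    refine and_congr ?_ (forall₂_congr fun k _ => ?_)
    · exact Iff.trans (by simp) (Part.mem_map_iff _).symm
    · exact Iff.trans (exists_congr fun w => by simp [and_comm]) (Part.mem_map_iff _).symm

/-! ### Bounded quantifier formulas in `ω`-models -/

/-- An injective numbering of terms. -/
def L2Term.toNat {n : ℕ} : L2Term n → ℕ
  | var i => Nat.pair 0 i
  | zero => Nat.pair 1 0
  | one => Nat.pair 2 0
  | add s t => Nat.pair 3 (Nat.pair s.toNat t.toNat)
  | mul s t => Nat.pair 4 (Nat.pair s.toNat t.toNat)

theorem L2Term.toNat_injective {n : ℕ} : Function.Injective (L2Term.toNat (n := n)) := by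
  intro s t h
  induction s generalizing t with
  | var | zero | one => cases t <;> simp_all [L2Term.toNat, Fin.ext_iff]
  | add s s' ih ih' | mul s s' ih ih' =>
    cases t <;> simp [L2Term.toNat] at h ⊢
    exact ⟨ih h.1, ih' h.2⟩

/-- An injective numbering of bounded quantifier formulas. -/
def BddFormula.toNat {k : ℕ} : {n : ℕ} → BddFormula k n → ℕ
  | _, eq s t => Nat.pair 0 (Nat.pair s.toNat t.toNat)
  | _, lt s t => Nat.pair 1 (Nat.pair s.toNat t.toNat)
  | _, mem t X => Nat.pair 2 (Nat.pair t.toNat X)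
  | _, not φ => Nat.pair 3 φ.toNat
  | _, and φ ψ => Nat.pair 4 (Nat.pair φ.toNat ψ.toNat)
  | _, ball t φ => Nat.pair 5 (Nat.pair t.toNat φ.toNat)

theorem BddFormula.toNat_injective {k n : ℕ} :
    Function.Injective (BddFormula.toNat (k := k) (n := n)) := by
  intro φ ψ h
  induction φ with
  | eq | lt | mem =>
    cases ψ <;> simp_all [BddFormula.toNat, L2Term.toNat_injective.eq_iff, Fin.ext_iff]
  | not φ ih =>
    cases ψ <;> simp [BddFormula.toNat] at h ⊢
    exact ih h
  | and φ φ' ih ih' =>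
    cases ψ <;> simp [BddFormula.toNat] at h ⊢
    exact ⟨ih h.1, ih' h.2⟩
  | ball t φ ih =>
    cases ψ <;> simp [BddFormula.toNat, L2Term.toNat_injective.eq_iff] at h ⊢
    exact ⟨h.1, ih h.2⟩

instance (k n : ℕ) : Countable (BddFormula k n) := BddFormula.toNat_injective.countable

/-- The truth of a bounded quantifier formula depends on a finite part of the set variables. -/
theorem BddFormula.exists_use {k n : ℕ} (φ : BddFormula k n) (e : Fin n → ℕ) :
    ∃ N, ∀ S S' : Fin k → Set ℕ, (∀ i, ∀ x < N, (x ∈ S i ↔ x ∈ S' i)) →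
      (φ.Realize S e ↔ φ.Realize S' e) := by
  induction φ with
  | eq | lt => exact ⟨0, fun _ _ _ => Iff.rfl⟩
  | mem t X => exact ⟨t.eval e + 1, fun S S' h => h X _ (Nat.lt_succ_self _)⟩
  | not φ ih =>
    obtain ⟨N, hN⟩ := ih e
    exact ⟨N, fun S S' h => not_congr (hN S S' h)⟩
  | and φ ψ ih ih' =>
    obtain ⟨N, hN⟩ := ih e
    obtain ⟨N', hN'⟩ := ih' e
    exact ⟨max N N', fun S S' h => and_congr
      (hN S S' fun i x hx => h i x (by lia)) (hN' S S' fun i x hx => h i x (by lia))⟩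
  | ball t φ ih =>
    choose N hN using fun a => ih (Fin.cons a e)
    refine ⟨(Finset.range (t.eval e)).sup N, fun S S' h => forall₂_congr fun a ha => ?_⟩
    exact hN a S S' fun i x hx => h i x
      (hx.trans_le (Finset.le_sup (f := N) (Finset.mem_range.2 ha)))

/-- The position of `x` in the `i`-th column of an iterated join. -/
def column : ℕ → ℕ → ℕ
  | 0, x => 2 * x
  | i + 1, x => 2 * column i x + 1

/-- The `i`-th column of `Y`. -/
def columnSet (Y : Set ℕ) (i : ℕ) : Set ℕ := {x | column i x ∈ Y}

/-- A bounded quantifier formula with parameters. -/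
abbrev ParamFormula : Type := Σ k p : ℕ, BddFormula k (p + 2) × (Fin p → ℕ)

/-- Truth of a formula with parameters, the set variables being the columns of `Y`. -/
def ParamFormula.Holds (θ : ParamFormula) (Y : Set ℕ) (m n : ℕ) : Prop :=
  θ.2.2.1.Realize (fun i => columnSet Y i) (Fin.cons m (Fin.cons n θ.2.2.2 : Fin (θ.2.1 + 1) → ℕ))

/-- Enumeration of the set defined by `∃ m, θ(m, n)` from the facts of its set parameters. -/
def ParamFormula.op (θ : ParamFormula) (O : Set ℕ) : Set ℕ :=
  {n | ∃ m, ∃ F : Finset ℕ, (F : Set ℕ) ⊆ O ∧ ∀ Y, (F : Set ℕ) ⊆ facts Y → θ.Holds Y m n}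

theorem ParamFormula.isEnumOp (θ : ParamFormula) : IsEnumOp θ.op := fun _ =>
  .of_mono (fun _ _ h ⟨m, F, hF, hY⟩ => ⟨m, F, hF.trans h, hY⟩)
    fun _ ⟨m, F, hF, hY⟩ => ⟨F, hF, m, F, subset_rfl, hY⟩

/-- A true bounded formula consults its set variables only below some `N`. The finitely many true
facts about the column positions below `N` therefore force it for every set with those facts. -/
theorem ParamFormula.mem_op_facts {θ : ParamFormula} {Y : Set ℕ} {n : ℕ} :
    n ∈ θ.op (facts Y) ↔ ∃ m, θ.Holds Y m n := by
  classical
  refine exists_congr fun m => ⟨fun ⟨F, hF, h⟩ => h Y hF, fun h => ?_⟩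
  obtain ⟨N, hN⟩ := θ.2.2.1.exists_use (Fin.cons m (Fin.cons n θ.2.2.2 : Fin (θ.2.1 + 1) → ℕ))
  refine ⟨(Finset.range θ.1 ×ˢ Finset.range N).image fun q =>
    if column q.1 q.2 ∈ Y then 2 * column q.1 q.2 else 2 * column q.1 q.2 + 1, ?_, ?_⟩
  · intro k hk
    simp only [Finset.coe_image, Set.mem_image] at hk
    obtain ⟨q, -, rfl⟩ := hk
    split_ifs with hq <;> simpa
  · intro Y' hY'
    refine (hN _ _ fun i x hx => ?_).1 h
    have hmem : (i.1, x) ∈ Finset.range θ.1 ×ˢ Finset.range N := by simp [hx]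
    have := hY' (Finset.mem_coe.2 (Finset.mem_image_of_mem _ hmem))
    simp only [columnSet, Set.mem_ofPred_eq]
    split_ifs at this with hq <;> simp_all

/-! ### Finite sequences -/

/-- The pairing function of second-order arithmetic on the standard natural numbers. -/
def npair (a b : ℕ) : ℕ := (a + b) * (a + b) + a

/-- Since `a ≤ 2 * (a + b)`, the code lies between the squares of `a + b` and `a + b + 1`, so it
determines the sum and then `a`. -/
theorem npair_inj {a b c d : ℕ} : npair a b = npair c d ↔ a = c ∧ b = d := by
  refine ⟨fun h => ?_, fun ⟨h, h'⟩ => h ▸ h' ▸ rfl⟩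
  unfold npair at h
  have : a + b = c + d := by
    by_contra hne
    rcases Nat.lt_or_gt_of_ne hne with h' | h' <;> nlinarith
  rw [this] at h
  lia

theorem add_le_npair (a b : ℕ) : a + b ≤ npair a b := by
  have := Nat.le_mul_self (a + b)
  unfold npair
  lia

/-- The function `h` extends the finite sequence `σ`. -/
def Extends (h : ℕ → ℕ) (σ : List ℕ) : Prop := ∀ i a, σ[i]? = some a → h i = a

/-- The code of the graph of a function. -/
def graphSet (h : ℕ → ℕ) : Set ℕ := {k | ∃ n, k = npair n (h n)}

@[simp] theorem npair_mem_graphSet {h : ℕ → ℕ} {n a : ℕ} : npair n a ∈ graphSet h ↔ h n = a := by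
  simp only [graphSet, Set.mem_ofPred_eq, npair_inj]
  grind

/-- The facts about the graph of a function that are decided by a finite initial segment. -/
def partialFacts (σ : List ℕ) : Set ℕ := {k | ∀ h, Extends h σ → k ∈ facts (graphSet h)}

theorem partialFacts_mono {σ τ : List ℕ} (h : σ <+: τ) : partialFacts σ ⊆ partialFacts τ := by
  intro k hk f hf
  refine hk f fun i a hi => hf i a ?_
  obtain ⟨ρ, rfl⟩ := h
  rw [List.getElem?_append_left (List.getElem?_eq_some_iff.1 hi).1, hi]

theorem Extends.partialFacts_subset {h : ℕ → ℕ} {σ : List ℕ} (hσ : Extends h σ) :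
    partialFacts σ ⊆ facts (graphSet h) := fun _ hk => hk h hσ

/-- A fact `k` concerns a code at most `k`, and both coordinates of a pair are bounded by its code.
Hence only arguments below the length of `σ` matter. -/
theorem mem_partialFacts_of_mem_facts {h : ℕ → ℕ} {σ : List ℕ} {k : ℕ} (hσ : Extends h σ)
    (hk : k < σ.length) (hkh : k ∈ facts (graphSet h)) : k ∈ partialFacts σ := by
  intro h' hσ'
  refine (mem_facts_congr (Nat.lt_succ_self k) fun j hj => ?_).1 hkh
  refine exists_congr fun n => ?_
  by_cases hn : n < σ.length
  · rw [hσ n _ (List.getElem?_eq_getElem hn), hσ' n _ (List.getElem?_eq_getElem hn)]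
  · have := add_le_npair n (h n)
    have := add_le_npair n (h' n)
    constructor <;> intro <;> lia

/-- Increasing `σ` and decreasing `τ` such that all of `σ` lies below all of `τ`. -/
def IsSplit (lt : ℕ → ℕ → Prop) (σ τ : List ℕ) : Prop :=
  (σ.Pairwise lt ∧ τ.Pairwise fun a b => lt b a) ∧ ∀ a ∈ σ, ∀ b ∈ τ, lt a b

/-- The strict order that is read off from a set of facts. -/
def factLT (O : Set ℕ) (a b : ℕ) : Prop := 2 * npair a b ∈ O

theorem IsSplit.finitary (σ τ : List ℕ) : Finitary fun O => IsSplit (factLT O) σ τ :=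
  ((Finitary.pairwise (fun _ _ => .mem _) σ).and (Finitary.pairwise (fun _ _ => .mem _) τ)).and
    (.forall_mem (fun _ => .forall_mem (fun _ => .mem _) τ) σ)

/-! ### The countable family of operators -/

/-- The code of a pair of finite sets. -/
def setsCode (R S : Finset ℕ) : ℕ := Encodable.encode (R, S)

/-- The code of a pair of finite sequences. -/
def seqsCode (σ τ : List ℕ) : ℕ := Encodable.encode (σ, τ)

@[simp] theorem setsCode_inj {R S R' S' : Finset ℕ} :
    setsCode R S = setsCode R' S' ↔ R = R' ∧ S = S' := by
  simp [setsCode]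

@[simp] theorem seqsCode_inj {R S R' S' : List ℕ} :
    seqsCode R S = seqsCode R' S' ↔ R = R' ∧ S = S' := by
  simp [seqsCode]

/-- Codes for enumeration operators. -/
inductive OpCode : Type
  | id
  | left
  | right
  | turing (c : OracleCode)
  | sigma (θ : ParamFormula)
  | hitFst
  | hitSnd
  | upDown
  | upUp (ρ : List ℕ)
  | downDown (ρ : List ℕ)
  | extending (σ τ : List ℕ)
  | comp (a b : OpCode)
  | join (a b : OpCode)
  | amalg (e a b : OpCode)
deriving Countable

/-- The relation enumerated by `W` holds at some pair of subsets of `U` and `V`. -/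
def HoldsBelow (W : Set ℕ) (U V : Finset ℕ) : Prop :=
  ∃ R S : Finset ℕ, (R ⊆ U ∧ S ⊆ V) ∧ setsCode R S ∈ W

/-- The operator with a given code. The operator of `amalg e a b` enumerates the pairs `(U, V)`
such that for some pair of sequences enumerated by `e`, both relations `a` and `b`, relative to the
respective sequence, hold below `(U, V)`. -/
def OpCode.eval : OpCode → Set ℕ → Set ℕ
  | id, O => O
  | left, O => {n | 2 * n ∈ O}
  | right, O => {n | 2 * n + 1 ∈ O}
  -- If `c` computes a characteristic function, its values `1` and `0` yield the positive and the
  -- negative facts.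
  | turing c, O => turingJoin {n | c.Graph O n 1} {n | c.Graph O n 0}
  | sigma θ, O => θ.op O
  | hitFst, O => {k | ∃ R S, k = setsCode R S ∧ ∃ a, a ∈ R ∧ a ∈ O}
  | hitSnd, O => {k | ∃ R S, k = setsCode R S ∧ ∃ a, a ∈ S ∧ a ∈ O}
  | upDown, O => {k | ∃ σ τ, k = seqsCode σ τ ∧ IsSplit (factLT O) σ τ}
  | upUp ρ, O => {k | ∃ σ τ, k = seqsCode σ τ ∧ IsSplit (factLT O) σ ρ ∧ IsSplit (factLT O) τ ρ}
  | downDown ρ, O => {k | ∃ σ τ, k = seqsCode σ τ ∧ IsSplit (factLT O) ρ σ ∧ IsSplit (factLT O) ρ τ}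
  | extending σ τ, O => {k | (∃ σ' τ', k = seqsCode σ' τ' ∧ σ <+: σ' ∧ τ <+: τ') ∧ k ∈ O}
  | comp a b, O => a.eval (b.eval O)
  | join a b, O => turingJoin (a.eval O) (b.eval O)
  | amalg e a b, O => {k | ∃ U V, k = setsCode U V ∧ ∃ σ τ, seqsCode σ τ ∈ e.eval O ∧
      HoldsBelow (a.eval (turingJoin O (partialFacts σ))) U V ∧
      HoldsBelow (b.eval (turingJoin O (partialFacts τ))) U V}

theorem HoldsBelow.finitary {Φ : Set ℕ → Set ℕ} (h : IsEnumOp Φ) (U V : Finset ℕ) :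
    Finitary fun O => HoldsBelow (Φ O) U V :=
  .ex fun _ => .ex fun _ => (Finitary.const _).and (h _)

theorem OpCode.isEnumOp (c : OpCode) : IsEnumOp c.eval := by
  induction c with
  | id => exact .id
  | left => exact fun _ => .mem _
  | right => exact fun _ => .mem _
  | turing c =>
    exact IsEnumOp.turingJoin (fun n => c.finitary_graph n 1) fun n => c.finitary_graph n 0
  | sigma θ => exact θ.isEnumOp
  | hitFst | hitSnd =>
    exact fun _ => .ex fun _ => .ex fun _ => (Finitary.const _).and
      (.ex fun _ => (Finitary.const _).and (.mem _))
  | upDown =>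
    exact fun _ => .ex fun _ => .ex fun _ => (Finitary.const _).and (IsSplit.finitary _ _)
  | upUp ρ | downDown ρ =>
    exact fun _ => .ex fun _ => .ex fun _ => (Finitary.const _).and
      ((IsSplit.finitary _ _).and (IsSplit.finitary _ _))
  | extending σ τ => exact fun _ => (Finitary.const _).and (.mem _)
  | comp a b iha ihb => exact iha.comp ihb
  | join a b iha ihb => exact iha.turingJoin ihb
  | amalg e a b ihe iha ihb =>
    exact fun _ => .ex fun _ => .ex fun _ => (Finitary.const _).and (.ex fun _ => .ex fun _ =>
      (ihe _).and ((HoldsBelow.finitary (iha.comp (IsEnumOp.id.turingJoin (.const _))) _ _).and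
        (HoldsBelow.finitary (ihb.comp (IsEnumOp.id.turingJoin (.const _))) _ _)))

@[simp] theorem OpCode.eval_left_turingJoin (A B : Set ℕ) :
    OpCode.left.eval (turingJoin A B) = A := by
  ext n; simp [OpCode.eval]

@[simp] theorem OpCode.eval_right_turingJoin (A B : Set ℕ) :
    OpCode.right.eval (turingJoin A B) = B := by
  ext n; simp [OpCode.eval]

/-! ### Dependent hyperimmunity -/

/-- The relation on pairs of finite sets enumerated by `W` is essential: there are arbitrarily
large `R` such that `(R, S)` is enumerated for arbitrarily large `S`. -/
def Essential (W : Set ℕ) : Prop :=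
  ∀ x, ∃ R : Finset ℕ, (∀ a ∈ R, x < a) ∧ ∀ y, ∃ S : Finset ℕ, (∀ b ∈ S, y < b) ∧ setsCode R S ∈ W

/-- The relation enumerated by `W` holds at some pair of a subset of `A` and a subset of `Aᶜ`. -/
def MeetsPartition (A W : Set ℕ) : Prop :=
  ∃ R S : Finset ℕ, ((R : Set ℕ) ⊆ A ∧ (S : Set ℕ) ⊆ Aᶜ) ∧ setsCode R S ∈ W

/-- `A` and its complement are dependently hyperimmune relative to the set of facts `O`. -/
def DepHyperimmune (A O : Set ℕ) : Prop :=
  ∀ c : OpCode, Essential (c.eval O) → MeetsPartition A (c.eval O)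

theorem DepHyperimmune.eval {A O : Set ℕ} (h : DepHyperimmune A O) (c : OpCode) :
    DepHyperimmune A (c.eval O) := fun d => h (.comp d c)

theorem MeetsPartition.mono {A W W' : Set ℕ} (h : MeetsPartition A W) (hW : W ⊆ W') :
    MeetsPartition A W' := by
  obtain ⟨R, S, hRS, hm⟩ := h
  exact ⟨R, S, hRS, hW hm⟩

/-- For infinite `H`, the relations "`S` meets `H`" and "`R` meets `H`" are both essential, with the
other component empty. Meeting the partition puts an element of `H` into `Aᶜ` and into `A`,
respectively. -/
theorem DepHyperimmune.not_infinite_subset {A H : Set ℕ} (h : DepHyperimmune A (facts H))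
    (hH : ∀ x, ∃ y ∈ H, x < y) : ¬ H ⊆ A ∧ ¬ H ⊆ Aᶜ := by
  have hH' : DepHyperimmune A H := by simpa [facts] using h.eval .left
  constructor <;> intro hHA
  · obtain ⟨R, S, ⟨hR, hS⟩, hW⟩ := hH' .hitSnd (fun x => ⟨∅, by simp, fun y => by
      obtain ⟨z, hz, hyz⟩ := hH y
      exact ⟨{z}, by simpa using hyz, _, _, rfl, z, by simp, hz⟩⟩)
    obtain ⟨R', S', hc, a, haS, haH⟩ := hW
    obtain ⟨rfl, rfl⟩ := setsCode_inj.1 hc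
    exact hS haS (hHA haH)
  · obtain ⟨R, S, ⟨hR, hS⟩, hW⟩ := hH' .hitFst (fun x => by
      obtain ⟨z, hz, hxz⟩ := hH x
      exact ⟨{z}, by simpa using hxz, fun y => ⟨∅, by simp, _, _, rfl, z, by simp, hz⟩⟩)
    obtain ⟨R', S', hc, a, haR, haH⟩ := hW
    obtain ⟨rfl, rfl⟩ := setsCode_inj.1 hc
    exact hHA haH (hR haR)

theorem exists_seq_of_step {α : Type*} {r : ℕ → α → α → Prop} (a : α)
    (h : ∀ n x, ∃ y, r n x y) : ∃ f : ℕ → α, f 0 = a ∧ ∀ n, r n (f n) (f (n + 1)) := by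
  choose g hg using h
  exact ⟨fun n => Nat.rec a g n, rfl, fun n => hg _ _⟩

/-! ### A generic stable partial order -/

/-- A partial order of `ℕ` together with a stage, such that every element `a` before the stage is
either below all elements after the stage, in case `a ∈ lower`, or below none of them. -/
structure StagedPoset where
  stage : ℕ
  rel : ℕ → ℕ → Prop
  lower : Set ℕ
  refl : ∀ a, rel a a
  trans : ∀ a b c, rel a b → rel b c → rel a c
  le_of_rel : ∀ a b, rel a b → a ≤ b
  rel_iff : ∀ a b, a < stage → stage ≤ b → (rel a b ↔ a ∈ lower)

namespace StagedPoset

/-- `q` agrees with `p` before the stage of `p` and keeps the promises of `p` after it. -/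
structure Extension (p q : StagedPoset) : Prop where
  stage_le : p.stage ≤ q.stage
  rel_congr : ∀ a b, a < p.stage → b < p.stage → (q.rel a b ↔ p.rel a b)
  lower_congr : ∀ a, a < p.stage → (a ∈ q.lower ↔ a ∈ p.lower)
  promise : ∀ a b, a < p.stage → p.stage ≤ b → (q.rel a b ↔ a ∈ p.lower)

theorem Extension.refl (p : StagedPoset) : p.Extension p :=
  ⟨le_rfl, fun _ _ _ _ => Iff.rfl, fun _ _ => Iff.rfl, p.rel_iff⟩

theorem Extension.trans {p q r : StagedPoset} (h : p.Extension q) (h' : q.Extension r) :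
    p.Extension r where
  stage_le := h.stage_le.trans h'.stage_le
  rel_congr a b ha hb := (h'.rel_congr a b (ha.trans_le h.stage_le) (hb.trans_le h.stage_le)).trans
    (h.rel_congr a b ha hb)
  lower_congr a ha := (h'.lower_congr a (ha.trans_le h.stage_le)).trans (h.lower_congr a ha)
  promise a b ha hb := by
    rcases lt_or_ge b q.stage with hbq | hbq
    · exact (h'.rel_congr a b (ha.trans_le h.stage_le) hbq).trans (h.promise a b ha hb)
    · exact (h'.promise a b (ha.trans_le h.stage_le) hbq).trans (h.lower_congr a ha)

/-- Cut the order of `q` at `N`, keep the promises of `p`, and promise that of the elements between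
the stage of `p` and `N` just those before `m` are below almost all elements. -/
def cut {p q : StagedPoset} (h : p.Extension q) (m N : ℕ) (hm : p.stage ≤ m) : StagedPoset where
  stage := N
  rel a b := (b < N ∧ q.rel a b) ∨
    (a < N ∧ N ≤ b ∧ a < m ∧ (a < p.stage → a ∈ p.lower)) ∨ (N ≤ b ∧ a = b)
  lower := {a | a < m ∧ (a < p.stage → a ∈ p.lower)}
  refl a := by
    rcases lt_or_ge a N with ha | ha
    · exact Or.inl ⟨ha, q.refl a⟩
    · exact Or.inr (Or.inr ⟨ha, rfl⟩)
  trans a b c := by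
    -- The new `lower` is closed downwards under `q.rel`, as transitivity requires: `q.rel` respects
    -- `≤`, and the promises of `p` are inherited along `q.rel`.
    have key : q.rel a b → b < m → (b < p.stage → b ∈ p.lower) →
        a < m ∧ (a < p.stage → a ∈ p.lower) := by
      intro hab hbm hb
      have hle := q.le_of_rel a b hab
      refine ⟨by lia, fun ha => ?_⟩
      rcases lt_or_ge b p.stage with hbp | hbp
      · have hb' := (h.promise b p.stage hbp le_rfl).2 (hb hbp)
        exact (h.promise a p.stage ha le_rfl).1 (q.trans _ _ _ hab hb')
      · exact (h.promise a b ha hbp).1 hab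
    have htr := q.trans a b c
    have hle := q.le_of_rel a b
    have hle' := q.le_of_rel b c
    rintro (⟨h1, h2⟩ | h1 | ⟨h1, rfl⟩) (⟨h3, h4⟩ | h3 | ⟨h3, rfl⟩)
    · exact Or.inl ⟨h3, htr h2 h4⟩
    · have := key h2 h3.2.2.1 h3.2.2.2
      exact Or.inr (Or.inl ⟨by grind, h3.2.1, this⟩)
    · exact Or.inl ⟨h1, h2⟩
    all_goals grind
  le_of_rel a b := by
    have := q.le_of_rel a b
    grind
  rel_iff a b ha hb := by
    simp only [Set.mem_ofPred_eq]
    grind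

theorem extension_cut {p q : StagedPoset} (h : p.Extension q) {m N : ℕ} (hm : p.stage ≤ m)
    (hN : m ≤ N) : p.Extension (cut h m N hm) where
  stage_le := hm.trans hN
  rel_congr a b ha hb := by
    have := h.rel_congr a b ha hb
    simp only [cut]
    grind
  lower_congr a ha := by
    simp only [cut, Set.mem_ofPred_eq]
    grind
  promise a b ha hb := by
    have := h.promise a b ha hb
    simp only [cut]
    grind

/-- The set coding the order relation. -/
def relSet (r : ℕ → ℕ → Prop) : Set ℕ := {k | ∃ a b, k = npair a b ∧ r a b}

theorem npair_mem_relSet {r : ℕ → ℕ → Prop} {a b : ℕ} : npair a b ∈ relSet r ↔ r a b := by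
  simp only [relSet, Set.mem_ofPred_eq, npair_inj]
  grind

theorem mem_facts_relSet_congr {r r' : ℕ → ℕ → Prop} {N k : ℕ} (hk : k < N)
    (h : ∀ a b, a < N → b < N → (r a b ↔ r' a b)) :
    k ∈ facts (relSet r) ↔ k ∈ facts (relSet r') := by
  refine mem_facts_congr hk fun j hj => exists₂_congr fun a b => and_congr_right fun hab => h a b ?_ ?_
  all_goals
    have := add_le_npair a b
    lia

/-- If no extension makes the relation essential, there is nothing to do beyond advancing the stage.
Otherwise an essential extension supplies `R` past the stage of `p`, then `S` past a bound `m` for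
`R`. Cutting at `m` puts `R` into `lower` and keeps `S` out of it, and a late enough stage preserves
the finite part of the order that enumerates `(R, S)`. -/
theorem exists_extension_forces (p : StagedPoset) (c : OpCode) :
    ∃ q : StagedPoset, p.Extension q ∧ p.stage < q.stage ∧ ∀ r : StagedPoset, q.Extension r →
      Essential (c.eval (facts (relSet r.rel))) →
      MeetsPartition r.lower (c.eval (facts (relSet r.rel))) := by
  by_cases hess : ∃ q : StagedPoset, p.Extension q ∧ Essential (c.eval (facts (relSet q.rel)))
  · obtain ⟨q, hpq, hq⟩ := hess
    obtain ⟨R, hR, hRS⟩ := hq p.stage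
    set m := max p.stage (R.sup _root_.id + 1) with hm
    have hRm : ∀ a ∈ R, a < m := fun a ha => by
      have := Finset.le_sup (f := _root_.id) ha
      simp only [_root_.id] at this
      lia
    obtain ⟨S, hS, hW⟩ := hRS m
    obtain ⟨F, hF, hFW⟩ := (c.isEnumOp _ _).1 hW
    set N := max (m + 1) (max (S.sup _root_.id + 1) (F.sup _root_.id + 1)) with hN
    have hSN : ∀ a ∈ S, a < N := fun a ha => by
      have := Finset.le_sup (f := _root_.id) ha
      simp only [_root_.id] at this
      lia
    have hFN : ∀ a ∈ F, a < N := fun a ha => by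
      have := Finset.le_sup (f := _root_.id) ha
      simp only [_root_.id] at this
      lia
    have hpm : p.stage ≤ m := le_max_left _ _
    refine ⟨cut hpq m N hpm, extension_cut hpq hpm (by lia), by simp only [cut]; lia,
      fun r hr _ => ⟨R, S, ⟨fun a ha => ?_, fun a ha har => ?_⟩, (c.isEnumOp _).mono ?_ hFW⟩⟩
    · refine (hr.lower_congr a ((hRm a ha).trans_le (by simp only [cut]; lia))).2 ⟨hRm a ha, ?_⟩
      have := hR a ha
      lia
    · have := ((hr.lower_congr a (hSN a ha)).1 har).1
      have := hS a ha
      lia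
    · refine fun k hk => (mem_facts_relSet_congr (hFN k hk) fun a b ha hb => ?_).1 (hF hk)
      rw [hr.rel_congr a b ha hb]
      simp only [cut]
      grind
  · push Not at hess
    have h := extension_cut (Extension.refl p) (le_refl p.stage) (Nat.le_succ p.stage)
    exact ⟨_, h, Nat.lt_succ_self _, fun r hr hr' => (hess r (h.trans hr) hr').elim⟩

end StagedPoset

open StagedPoset in
/-- There is a stable partial order relative to which the set of elements that are below almost
every element and its complement are dependently hyperimmune. -/
theorem exists_generic_poset : ∃ (r : ℕ → ℕ → Prop) (A : Set ℕ),
    (∀ a, r a a) ∧ (∀ a b c, r a b → r b c → r a c) ∧ (∀ a b, r a b → a ≤ b) ∧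
    (∀ a, ∃ n, ∀ b, n ≤ b → (r a b ↔ a ∈ A)) ∧ DepHyperimmune A (facts (relSet r)) := by
  have : Nonempty OpCode := ⟨.id⟩
  obtain ⟨e, he⟩ := exists_surjective_nat OpCode
  let p₀ : StagedPoset := ⟨0, Eq, ∅, fun _ => rfl, fun _ _ _ => Eq.trans, fun _ _ => le_of_eq,
    fun a _ h => (Nat.not_lt_zero a h).elim⟩
  obtain ⟨p, -, hp⟩ := exists_seq_of_step p₀ fun n p => exists_extension_forces p (e n)
  have hext : ∀ i j, i ≤ j → (p i).Extension (p j) := by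
    intro i j hij
    induction j, hij using Nat.le_induction with
    | base => exact .refl _
    | succ j _ ih => exact ih.trans (hp j).1
  have hstage : ∀ i, i ≤ (p i).stage := by
    intro i
    induction i with
    | zero => exact Nat.zero_le _
    | succ i ih => exact Nat.succ_le_of_lt (ih.trans_lt (hp i).2.1)
  -- The stage of `p i` is at least `i`, so at this index both `a` and `b` are already before the
  -- stage.
  let r : ℕ → ℕ → Prop := fun a b => (p (max a b + 1)).rel a b
  let A : Set ℕ := {a | a ∈ (p (a + 1)).lower}
  have hr : ∀ i a b, a < (p i).stage → b < (p i).stage → (r a b ↔ (p i).rel a b) := by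
    intro i a b ha hb
    have := hstage (max a b + 1)
    rcases le_total i (max a b + 1) with h | h
    · exact (hext _ _ h).rel_congr a b ha hb
    · exact ((hext _ _ h).rel_congr a b (by lia) (by lia)).symm
  have hA : ∀ i a, a < (p i).stage → (a ∈ A ↔ a ∈ (p i).lower) := by
    intro i a ha
    have := hstage (a + 1)
    rcases le_total i (a + 1) with h | h
    · exact (hext _ _ h).lower_congr a ha
    · exact ((hext _ _ h).lower_congr a (by lia)).symm
  have hrefl : ∀ a, r a a := fun a => (p _).refl a
  have htrans : ∀ a b c, r a b → r b c → r a c := by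
    intro a b c hab hbc
    have := hstage (a + b + c + 1)
    rw [hr (a + b + c + 1) _ _ (by lia) (by lia)] at hab hbc ⊢
    exact (p _).trans _ _ _ hab hbc
  have hle : ∀ a b, r a b → a ≤ b := fun a b => (p _).le_of_rel a b
  have hprom : ∀ i a b, a < (p i).stage → (p i).stage ≤ b → (r a b ↔ a ∈ (p i).lower) := by
    intro i a b ha hb
    have := hstage b
    have hib := hext i (i + b + 1) (by lia)
    have := hstage (i + b + 1)
    rw [hr (i + b + 1) _ _ (by lia) (by lia)]
    exact hib.promise a b ha hb
  -- Conditions carry an order of all of `ℕ`, so the limit order is itself a condition extending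
  -- each `p i`, and what was forced applies to it directly.
  let M : ℕ → StagedPoset := fun i => ⟨(p i).stage, r, A, hrefl, htrans, hle,
    fun a b ha hb => (hprom i a b ha hb).trans (hA i a ha).symm⟩
  have hM : ∀ i, (p i).Extension (M i) := fun i =>
    ⟨le_rfl, hr i, hA i, hprom i⟩
  refine ⟨r, A, hrefl, htrans, hle, fun a => ?_, fun c hc => ?_⟩
  · exact ⟨(p (a + 1)).stage, fun b hb => (M (a + 1)).rel_iff a b (hstage (a + 1)) hb⟩
  · obtain ⟨i, rfl⟩ := he c
    exact (hp i).2.2 (M (i + 1)) (hM (i + 1)) hc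

/-! ### Generic pairs of sequences -/

theorem Extends.eq_map {f : ℕ → ℕ} {σ : List ℕ} (h : Extends f σ) :
    σ = (List.range σ.length).map f := by
  refine List.ext_getElem (by simp) fun i hi _ => ?_
  simpa using (h i _ (List.getElem?_eq_getElem hi)).symm

theorem extends_map_range (f : ℕ → ℕ) (n : ℕ) : Extends f ((List.range n).map f) := by
  intro i a h
  obtain ⟨_, rfl⟩ := List.getElem?_eq_some_iff.1 h
  simp

theorem map_range_prefix (f : ℕ → ℕ) {m n : ℕ} (h : m ≤ n) :
    (List.range m).map f <+: (List.range n).map f := by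
  rw [List.prefix_iff_eq_take, ← List.map_take, List.take_range]
  simp [h]

theorem exists_extends_of_chain {s : ℕ → List ℕ} (hs : ∀ i j, i ≤ j → s i <+: s j)
    (hlen : ∀ i, i ≤ (s i).length) : ∃ f, ∀ i, Extends f (s i) := by
  -- The default `0` is never used, as `s (i + 1)` has length at least `i + 1`.
  refine ⟨fun i => (s (i + 1)).getD i 0, fun i j a h => ?_⟩
  have hlt : j < (s (j + 1)).length := hlen (j + 1)
  obtain ⟨hi, rfl⟩ := List.getElem?_eq_some_iff.1 h
  simp only [List.getD_eq_getElem?_getD, List.getElem?_eq_getElem hlt, Option.getD_some]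
  rcases le_total i (j + 1) with hij | hij
  · exact ((hs _ _ hij).getElem hi).symm
  · exact (hs _ _ hij).getElem hlt

theorem exists_use_of_mem_graph {Φ : Set ℕ → Set ℕ} (hΦ : IsEnumOp Φ) {O : Set ℕ} {f : ℕ → ℕ}
    {k : ℕ} (hk : k ∈ Φ (turingJoin O (facts (graphSet f)))) :
    ∃ N, ∀ n ≥ N, k ∈ Φ (turingJoin O (partialFacts ((List.range n).map f))) := by
  obtain ⟨F, hF, hkF⟩ := (hΦ k _).1 hk
  refine ⟨F.sup id + 1, fun n hn => hΦ.mono (fun j hj => ?_) hkF⟩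
  have hle : j ≤ F.sup id := Finset.le_sup (f := id) hj
  have hjF := hF hj
  obtain ⟨i, rfl | rfl⟩ := Nat.even_or_odd' j
  · simpa using hjF
  · rw [two_mul_add_one_mem_turingJoin] at hjF ⊢
    exact mem_partialFacts_of_mem_facts (extends_map_range f n) (by simp; lia) hjF

theorem seqsCode_mem_extending {σ τ σ' τ' : List ℕ} {O : Set ℕ} :
    seqsCode σ' τ' ∈ (OpCode.extending σ τ).eval O ↔
      (σ <+: σ' ∧ τ <+: τ') ∧ seqsCode σ' τ' ∈ O := by
  simp only [OpCode.eval, Set.mem_ofPred_eq, seqsCode_inj]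
  grind

theorem setsCode_mem_amalg {e a b : OpCode} {U V : Finset ℕ} {O : Set ℕ} :
    setsCode U V ∈ (OpCode.amalg e a b).eval O ↔ ∃ σ τ, seqsCode σ τ ∈ e.eval O ∧
      HoldsBelow (a.eval (turingJoin O (partialFacts σ))) U V ∧
      HoldsBelow (b.eval (turingJoin O (partialFacts τ))) U V := by
  simp only [OpCode.eval, Set.mem_ofPred_eq, setsCode_inj]
  grind

theorem HoldsBelow.meetsPartition {A W : Set ℕ} {U V : Finset ℕ} (h : HoldsBelow W U V)
    (hU : (U : Set ℕ) ⊆ A) (hV : (V : Set ℕ) ⊆ Aᶜ) : MeetsPartition A W := by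
  obtain ⟨R, S, ⟨hR, hS⟩, hW⟩ := h
  exact ⟨R, S, ⟨subset_trans (by exact_mod_cast hR) hU, subset_trans (by exact_mod_cast hS) hV⟩, hW⟩

/-- If two relations are essential relative to `f` and `g`, then so is their amalgam. -/
theorem Essential.amalg {O : Set ℕ} {e a b : OpCode} {f g : ℕ → ℕ}
    (hfg : ∀ n, seqsCode ((List.range n).map f) ((List.range n).map g) ∈ e.eval O)
    {σ τ : List ℕ} (hσ : Extends f σ) (hτ : Extends g τ)
    (ha : Essential (a.eval (turingJoin O (facts (graphSet f)))))
    (hb : Essential (b.eval (turingJoin O (facts (graphSet g))))) :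
    Essential ((OpCode.amalg (.comp (.extending σ τ) e) a b).eval O) := by
  intro x
  obtain ⟨R, hR, hRS⟩ := ha x
  obtain ⟨R', hR', hRS'⟩ := hb x
  -- The amalgam only asks for subsets of its pair, so unions accommodate the witnesses of both
  -- relations.
  refine ⟨R ∪ R', by simpa [or_imp, forall_and] using ⟨hR, hR'⟩, fun y => ?_⟩
  obtain ⟨S, hS, hW⟩ := hRS y
  obtain ⟨S', hS', hW'⟩ := hRS' y
  refine ⟨S ∪ S', by simpa [or_imp, forall_and] using ⟨hS, hS'⟩, setsCode_mem_amalg.2 ?_⟩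
  obtain ⟨N, hN⟩ := exists_use_of_mem_graph a.isEnumOp hW
  obtain ⟨N', hN'⟩ := exists_use_of_mem_graph b.isEnumOp hW'
  -- Long enough for both enumerations and for the segments to extend `σ` and `τ`.
  set n := N + N' + σ.length + τ.length with hn
  refine ⟨(List.range n).map f, (List.range n).map g, seqsCode_mem_extending.2 ⟨⟨?_, ?_⟩, hfg n⟩,
    ⟨R, S, ⟨Finset.subset_union_left, Finset.subset_union_left⟩, hN n (by lia)⟩,
    ⟨R', S', ⟨Finset.subset_union_right, Finset.subset_union_right⟩, hN' n (by lia)⟩⟩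
  · rw [hσ.eq_map]
    exact map_range_prefix f (by lia)
  · rw [hτ.eq_map]
    exact map_range_prefix g (by lia)

/-- Forcing with pairs of finite sequences preserves dependent hyperimmunity relative to at least
one of the two generic sequences, provided that a pair of extensions of a condition always yields
a condition in which one of the two extensions is made. -/
theorem DepHyperimmune.exists_generic_pair {A O : Set ℕ} (hO : DepHyperimmune A O) (e : OpCode)
    (C : List ℕ → List ℕ → Prop) {σ₀ τ₀ : List ℕ} (h₀ : C σ₀ τ₀)
    (hmem : ∀ σ τ, C σ τ → seqsCode σ τ ∈ e.eval O)
    (hprefix : ∀ σ τ σ' τ', σ <+: σ' → τ <+: τ' → seqsCode σ' τ' ∈ e.eval O →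
      seqsCode σ τ ∈ e.eval O)
    (hsplit : ∀ σ τ σ' τ', C σ τ → σ <+: σ' → τ <+: τ' → seqsCode σ' τ' ∈ e.eval O →
      C σ' τ ∨ C σ τ')
    (hfst : ∀ σ τ, C σ τ → ∃ σ' τ', C σ' τ' ∧ (σ <+: σ' ∧ τ <+: τ') ∧ σ.length < σ'.length)
    (hsnd : ∀ σ τ, C σ τ → ∃ σ' τ', C σ' τ' ∧ (σ <+: σ' ∧ τ <+: τ') ∧ τ.length < τ'.length) :
    ∃ f g : ℕ → ℕ, (∀ n, seqsCode ((List.range n).map f) ((List.range n).map g) ∈ e.eval O) ∧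
      (DepHyperimmune A (turingJoin O (facts (graphSet f))) ∨
        DepHyperimmune A (turingJoin O (facts (graphSet g)))) := by
  have step : ∀ (ab : OpCode × OpCode) (p : {p : List ℕ × List ℕ // C p.1 p.2}),
      ∃ q : {p : List ℕ × List ℕ // C p.1 p.2}, (p.1.1 <+: q.1.1 ∧ p.1.2 <+: q.1.2) ∧
        (p.1.1.length < q.1.1.length ∧ p.1.2.length < q.1.2.length) ∧
        (MeetsPartition A (ab.1.eval (turingJoin O (partialFacts q.1.1))) ∨
          MeetsPartition A (ab.2.eval (turingJoin O (partialFacts q.1.2))) ∨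
          ¬ Essential ((OpCode.amalg (.comp (.extending p.1.1 p.1.2) e) ab.1 ab.2).eval O)) := by
    rintro ⟨a, b⟩ ⟨⟨σ, τ⟩, hp⟩
    obtain ⟨σ₁, τ₁, hC₁, ⟨hσ₁, hτ₁⟩, hdec⟩ : ∃ σ₁ τ₁, C σ₁ τ₁ ∧ (σ <+: σ₁ ∧ τ <+: τ₁) ∧
        (MeetsPartition A (a.eval (turingJoin O (partialFacts σ₁))) ∨
          MeetsPartition A (b.eval (turingJoin O (partialFacts τ₁))) ∨
          ¬ Essential ((OpCode.amalg (.comp (.extending σ τ) e) a b).eval O)) := by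
      -- An essential amalgam gives a pair `(U, V)` split by `A` below which both relations hold, so
      -- whichever extension `hsplit` permits settles its own relation. A non-essential one rules
      -- out that both relations are essential in the end.
      by_cases hess : Essential ((OpCode.amalg (.comp (.extending σ τ) e) a b).eval O)
      · obtain ⟨U, V, ⟨hU, hV⟩, hUV⟩ := hO _ hess
        obtain ⟨σ', τ', he, ha, hb⟩ := setsCode_mem_amalg.1 hUV
        obtain ⟨⟨hσ, hτ⟩, he⟩ := seqsCode_mem_extending.1 he
        rcases hsplit σ τ σ' τ' hp hσ hτ he with h | h
        · exact ⟨_, _, h, ⟨hσ, List.prefix_rfl⟩, Or.inl (ha.meetsPartition hU hV)⟩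
        · exact ⟨_, _, h, ⟨List.prefix_rfl, hτ⟩, Or.inr (Or.inl (hb.meetsPartition hU hV))⟩
      · exact ⟨σ, τ, hp, ⟨List.prefix_rfl, List.prefix_rfl⟩, Or.inr (Or.inr hess)⟩
    obtain ⟨σ₂, τ₂, hC₂, ⟨hσ₂, hτ₂⟩, hl₂⟩ := hfst _ _ hC₁
    obtain ⟨σ₃, τ₃, hC₃, ⟨hσ₃, hτ₃⟩, hl₃⟩ := hsnd _ _ hC₂
    refine ⟨⟨(σ₃, τ₃), hC₃⟩, ⟨hσ₁.trans (hσ₂.trans hσ₃), hτ₁.trans (hτ₂.trans hτ₃)⟩, ⟨?_, ?_⟩, ?_⟩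
    · exact hσ₁.length_le.trans_lt (hl₂.trans_le hσ₃.length_le)
    · exact (hτ₁.trans hτ₂).length_le.trans_lt hl₃
    · refine hdec.imp (fun h => h.mono ?_) (Or.imp_left fun h => h.mono ?_)
      · exact a.isEnumOp.mono
          (turingJoin_mono subset_rfl (partialFacts_mono (hσ₂.trans hσ₃)))
      · exact b.isEnumOp.mono
          (turingJoin_mono subset_rfl (partialFacts_mono (hτ₂.trans hτ₃)))
  have : Nonempty OpCode := ⟨.id⟩
  obtain ⟨d, hd⟩ := exists_surjective_nat (OpCode × OpCode)
  obtain ⟨p, -, hp⟩ := exists_seq_of_step (⟨(σ₀, τ₀), h₀⟩ : {p : List ℕ × List ℕ // C p.1 p.2})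
    fun n => step (d n)
  have hchain : ∀ i j, i ≤ j → (p i).1.1 <+: (p j).1.1 ∧ (p i).1.2 <+: (p j).1.2 := by
    intro i j hij
    induction j, hij using Nat.le_induction with
    | base => exact ⟨List.prefix_rfl, List.prefix_rfl⟩
    | succ j _ ih => exact ⟨ih.1.trans (hp j).1.1, ih.2.trans (hp j).1.2⟩
  have hlen : ∀ i, i ≤ (p i).1.1.length ∧ i ≤ (p i).1.2.length := by
    intro i
    induction i with
    | zero => exact ⟨Nat.zero_le _, Nat.zero_le _⟩
    | succ i ih => exact ⟨ih.1.trans_lt (hp i).2.1.1, ih.2.trans_lt (hp i).2.1.2⟩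
  obtain ⟨f, hf⟩ := exists_extends_of_chain (fun i j h => (hchain i j h).1) fun i => (hlen i).1
  obtain ⟨g, hg⟩ := exists_extends_of_chain (fun i j h => (hchain i j h).2) fun i => (hlen i).2
  have hfg : ∀ n, seqsCode ((List.range n).map f) ((List.range n).map g) ∈ e.eval O := by
    intro n
    refine hprefix _ _ _ _ ?_ ?_ (hmem _ _ (p n).2)
    · rw [(hf n).eq_map]
      exact map_range_prefix f (hlen n).1
    · rw [(hg n).eq_map]
      exact map_range_prefix g (hlen n).2
  refine ⟨f, g, hfg, ?_⟩
  by_contra! hcon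
  simp only [DepHyperimmune, not_forall] at hcon
  obtain ⟨⟨a, ha, ha'⟩, b, hb, hb'⟩ := hcon
  -- If both `f` and `g` failed, by `a` and `b`, the stage treating the pair `(a, b)` would be
  -- contradicted in each of its three outcomes.
  obtain ⟨i, hi⟩ := hd (a, b)
  have hi' := (hp i).2.2
  rw [hi] at hi'
  rcases hi' with h | h | h
  · exact ha' (h.mono (a.isEnumOp.mono (turingJoin_mono subset_rfl (hf _).partialFacts_subset)))
  · exact hb' (h.mono (b.isEnumOp.mono (turingJoin_mono subset_rfl (hg _).partialFacts_subset)))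
  · exact h (Essential.amalg hfg (hf i) (hg i) ha hb)

/-! ### Solutions of `ADS` -/

/-! ### Splits of a linear order and the intervals they leave -/

section LinearOrder

variable {lt : ℕ → ℕ → Prop}

theorem IsSplit.of_prefix {σ τ σ' τ' : List ℕ} (h : IsSplit lt σ' τ') (hσ : σ <+: σ')
    (hτ : τ <+: τ') : IsSplit lt σ τ :=
  ⟨⟨h.1.1.sublist hσ.sublist, h.1.2.sublist hτ.sublist⟩,
    fun a ha b hb => h.2 a (hσ.subset ha) b (hτ.subset hb)⟩

theorem isSplit_swap {σ τ : List ℕ} : IsSplit (fun a b => lt b a) τ σ ↔ IsSplit lt σ τ :=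
  and_congr and_comm ⟨fun h a ha b hb => h b hb a ha, fun h b hb a ha => h a ha b hb⟩

/-- The elements strictly between all of `σ` and all of `τ`. -/
def between (lt : ℕ → ℕ → Prop) (σ τ : List ℕ) : Set ℕ :=
  {a | (∀ s ∈ σ, lt s a) ∧ ∀ t ∈ τ, lt a t}

theorem between_swap {σ τ : List ℕ} : between (fun a b => lt b a) τ σ = between lt σ τ :=
  Set.ext fun _ => and_comm

theorem IsSplit.append_left {σ τ : List ℕ} (h : IsSplit lt σ τ) {a : ℕ} (ha : a ∈ between lt σ τ) :
    IsSplit lt (σ ++ [a]) τ := by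
  refine ⟨⟨List.pairwise_append.2 ⟨h.1.1, by simp, ?_⟩, h.1.2⟩, ?_⟩
  · simpa using ha.1
  · intro b hb
    rcases List.mem_append.1 hb with hb | hb
    · exact h.2 b hb
    · rw [List.mem_singleton.1 hb]
      exact ha.2

theorem IsSplit.append_right {σ τ : List ℕ} (h : IsSplit lt σ τ) {a : ℕ}
    (ha : a ∈ between lt σ τ) : IsSplit lt σ (τ ++ [a]) :=
  isSplit_swap.1 ((isSplit_swap.2 h).append_left (between_swap ▸ ha))

/-- A point of the old interval in neither new one would be at or below some `s ∈ σ'` and at or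
above some `t ∈ τ'`, although `s` is below `t`. Hence, if the old interval is infinite, extending
one of the two sides alone leaves an infinite interval. -/
theorem between_subset_union (htrans : ∀ a b c, lt a b → lt b c → lt a c)
    (htri : ∀ a b, lt a b ∨ a = b ∨ lt b a) {σ τ σ' τ' : List ℕ} (h : IsSplit lt σ' τ') :
    between lt σ τ ⊆ between lt σ' τ ∪ between lt σ τ' := by
  intro a ha
  by_contra hcon
  rw [Set.mem_union, not_or] at hcon
  obtain ⟨s, hs, hsa⟩ : ∃ s ∈ σ', ¬ lt s a := by
    by_contra! h'
    exact hcon.1 ⟨h', ha.2⟩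
  obtain ⟨t, ht, hat⟩ : ∃ t ∈ τ', ¬ lt a t := by
    by_contra! h'
    exact hcon.2 ⟨ha.1, h'⟩
  have hst := h.2 s hs t ht
  grind

/-- The interval behaves like order type `ω`: each of its points has finitely many of its points
below. The entries of `σ` after `σ₀` lie in the interval, so all but finitely many of its points are
above them and may be appended. -/
theorem exists_append_of_finite (htri : ∀ a b, lt a b ∨ a = b ∨ lt b a) {σ₀ τ : List ℕ}
    (hinf : (between lt σ₀ τ).Infinite)
    (hfin : ∀ c ∈ between lt σ₀ τ, (between lt σ₀ (τ ++ [c])).Finite) {σ : List ℕ}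
    (hσ : σ₀ <+: σ) (h : IsSplit lt σ τ) : ∃ a, IsSplit lt (σ ++ [a]) τ := by
  obtain ⟨ρ, rfl⟩ := hσ
  have hρ : ∀ s ∈ ρ, s ∈ between lt σ₀ τ := fun s hs =>
    ⟨fun s' hs' => (List.pairwise_append.1 h.1.1).2.2 s' hs' s hs,
      fun t ht => h.2 s (List.mem_append_right _ hs) t ht⟩
  have hbad : (⋃ s ∈ {s | s ∈ ρ}, (between lt σ₀ (τ ++ [s]) ∪ {s})).Finite :=
    (List.finite_toSet ρ).biUnion fun s hs => (hfin s (hρ s hs)).union (Set.finite_singleton s)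
  obtain ⟨a, ha, ha'⟩ := (hinf.sdiff hbad).nonempty
  refine ⟨a, h.append_left ⟨fun s hs => ?_, ha.2⟩⟩
  rcases List.mem_append.1 hs with hs | hs
  · exact ha.1 s hs
  · by_contra hsa
    refine ha' (Set.mem_biUnion hs ?_)
    simp only [between, Set.mem_union, Set.mem_ofPred_eq, Set.mem_singleton_iff]
    grind [between]

end LinearOrder

theorem forall_lt_of_pairwise {r : ℕ → ℕ → Prop} {f : ℕ → ℕ}
    (h : ∀ n, ((List.range n).map f).Pairwise r) (i j : ℕ) (hij : i < j) : r (f i) (f j) := by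
  have h' := List.pairwise_iff_getElem.1 (List.pairwise_map.1 (h (j + 1))) i j
  simpa [hij, hij.le] using h'

theorem seqsCode_mem_upDown {σ τ : List ℕ} {O : Set ℕ} :
    seqsCode σ τ ∈ OpCode.upDown.eval O ↔ IsSplit (factLT O) σ τ := by
  simp only [OpCode.eval, Set.mem_ofPred_eq, seqsCode_inj]
  grind

theorem seqsCode_mem_upUp {ρ σ τ : List ℕ} {O : Set ℕ} :
    seqsCode σ τ ∈ (OpCode.upUp ρ).eval O ↔
      IsSplit (factLT O) σ ρ ∧ IsSplit (factLT O) τ ρ := by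
  simp only [OpCode.eval, Set.mem_ofPred_eq, seqsCode_inj]
  grind

theorem seqsCode_mem_downDown {ρ σ τ : List ℕ} {O : Set ℕ} :
    seqsCode σ τ ∈ (OpCode.downDown ρ).eval O ↔
      IsSplit (factLT O) ρ σ ∧ IsSplit (factLT O) ρ τ := by
  simp only [OpCode.eval, Set.mem_ofPred_eq, seqsCode_inj]
  grind

/-- Genericity for pairs of sequences that can be extended independently of each other. -/
theorem DepHyperimmune.exists_generic_of_tree {A O : Set ℕ} (hO : DepHyperimmune A O) (e : OpCode)
    (T : List ℕ → Prop) (hT : ∀ σ τ, σ <+: τ → T τ → T σ)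
    (he : ∀ σ τ, seqsCode σ τ ∈ e.eval O ↔ T σ ∧ T τ) {σ₀ : List ℕ} (h₀ : T σ₀)
    (hext : ∀ σ, σ₀ <+: σ → T σ → ∃ a, T (σ ++ [a])) :
    ∃ f : ℕ → ℕ, (∀ n, T ((List.range n).map f)) ∧
      DepHyperimmune A (turingJoin O (facts (graphSet f))) := by
  obtain ⟨f, g, hfg, h⟩ := hO.exists_generic_pair e
    (fun σ τ => (σ₀ <+: σ ∧ σ₀ <+: τ) ∧ T σ ∧ T τ) (σ₀ := σ₀) (τ₀ := σ₀)
    ⟨⟨List.prefix_rfl, List.prefix_rfl⟩, h₀, h₀⟩ (fun σ τ h => (he σ τ).2 h.2)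
    (fun σ τ σ' τ' hσ hτ h => (he σ τ).2
      ⟨hT _ _ hσ ((he σ' τ').1 h).1, hT _ _ hτ ((he σ' τ').1 h).2⟩)
    -- The two sequences do not constrain each other, so extending the first alone always gives a
    -- condition.
    (fun σ τ σ' τ' h hσ hτ h' => Or.inl ⟨⟨h.1.1.trans hσ, h.1.2⟩, ((he σ' τ').1 h').1, h.2.2⟩)
    (fun σ τ h => by
      obtain ⟨a, ha⟩ := hext σ h.1.1 h.2.1
      exact ⟨σ ++ [a], τ, ⟨⟨h.1.1.trans (List.prefix_append _ _), h.1.2⟩, ha, h.2.2⟩,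
        ⟨List.prefix_append _ _, List.prefix_rfl⟩, by simp⟩)
    (fun σ τ h => by
      obtain ⟨a, ha⟩ := hext τ h.1.2 h.2.2
      exact ⟨σ, τ ++ [a], ⟨⟨h.1.1, h.1.2.trans (List.prefix_append _ _)⟩, h.2.1, ha⟩,
        ⟨List.prefix_rfl, List.prefix_append _ _⟩, by simp⟩)
  rcases h with h | h
  · exact ⟨f, fun n => ((he _ _).1 (hfg n)).1, h⟩
  · exact ⟨g, fun n => ((he _ _).1 (hfg n)).2, h⟩

/-- Dependent hyperimmunity is preserved by some ascending or descending sequence of a given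
linear order. -/
theorem DepHyperimmune.exists_monotone_seq {A O : Set ℕ} (hO : DepHyperimmune A O) (l : OpCode)
    {lt : ℕ → ℕ → Prop} (hlt : factLT (l.eval O) = lt)
    (htrans : ∀ a b c, lt a b → lt b c → lt a c) (htri : ∀ a b, lt a b ∨ a = b ∨ lt b a) :
    ∃ f : ℕ → ℕ, ((∀ i j, i < j → lt (f i) (f j)) ∨ ∀ i j, i < j → lt (f j) (f i)) ∧
      DepHyperimmune A (turingJoin O (facts (graphSet f))) := by
  let C : List ℕ → List ℕ → Prop := fun σ τ => IsSplit lt σ τ ∧ (between lt σ τ).Infinite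
  -- If both coordinates of a condition can always be lengthened, the pair forcing applies.
  -- Otherwise some condition is stuck on one side, and its interval has order type `ω` or its
  -- reverse; monotone sequences growing into the other side then extend freely.
  by_cases hsnd : ∀ σ τ, C σ τ → ∃ σ' τ', C σ' τ' ∧ (σ <+: σ' ∧ τ <+: τ') ∧ τ.length < τ'.length
  · by_cases hfst : ∀ σ τ, C σ τ →
        ∃ σ' τ', C σ' τ' ∧ (σ <+: σ' ∧ τ <+: τ') ∧ σ.length < σ'.length
    · have he : ∀ σ τ, seqsCode σ τ ∈ (OpCode.comp .upDown l).eval O ↔ IsSplit lt σ τ :=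
        fun σ τ => hlt ▸ seqsCode_mem_upDown
      obtain ⟨f, g, hfg, h⟩ := hO.exists_generic_pair (.comp .upDown l) C (σ₀ := []) (τ₀ := [])
        ⟨by simp [IsSplit], by simpa [between] using Set.infinite_univ⟩
        (fun σ τ h => (he σ τ).2 h.1)
        (fun σ τ σ' τ' hσ hτ h => (he σ τ).2 (((he σ' τ').1 h).of_prefix hσ hτ))
        (fun σ τ σ' τ' h hσ hτ h' => by
          have hs := (he σ' τ').1 h'
          rcases Set.infinite_union.1 (h.2.mono (between_subset_union htrans htri hs)) with
            hi | hi
          · exact Or.inl ⟨hs.of_prefix List.prefix_rfl hτ, hi⟩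
          · exact Or.inr ⟨hs.of_prefix hσ List.prefix_rfl, hi⟩)
        hfst hsnd
      have hfg' := fun n => (he _ _).1 (hfg n)
      rcases h with h | h
      · exact ⟨f, Or.inl (forall_lt_of_pairwise fun n => (hfg' n).1.1), h⟩
      · exact ⟨g, Or.inr (forall_lt_of_pairwise fun n => (hfg' n).1.2), h⟩
    · push Not at hfst
      obtain ⟨σ, τ, ⟨hs, hinf⟩, hstuck⟩ := hfst
      obtain ⟨f, hf, h⟩ := hO.exists_generic_of_tree (.comp (.downDown σ) l) (IsSplit lt σ)
        (fun _ _ h hs => hs.of_prefix List.prefix_rfl h) (fun _ _ => hlt ▸ seqsCode_mem_downDown) hs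
        fun ρ hρ hsρ => by
          -- Adding any interval point to the ascending side leaves a finite interval, so the
          -- reversed order satisfies the finiteness condition and the descending side can grow.
          obtain ⟨a, ha⟩ := exists_append_of_finite (lt := fun a b => lt b a) (σ₀ := τ) (τ := σ)
            (fun a b => by grind)
            (by rwa [between_swap]) (fun c hc => by
              rw [between_swap] at hc ⊢
              by_contra hinf'
              exact absurd (hstuck (σ ++ [c]) τ ⟨hs.append_left hc, hinf'⟩
                ⟨List.prefix_append _ _, List.prefix_rfl⟩) (by simp)) hρ (isSplit_swap.2 hsρ)
          exact ⟨a, isSplit_swap.1 ha⟩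
      exact ⟨f, Or.inr (forall_lt_of_pairwise fun n => (hf n).1.2), h⟩
  · push Not at hsnd
    obtain ⟨σ, τ, ⟨hs, hinf⟩, hstuck⟩ := hsnd
    obtain ⟨f, hf, h⟩ := hO.exists_generic_of_tree (.comp (.upUp τ) l) (IsSplit lt · τ)
      (fun _ _ h hs => hs.of_prefix h List.prefix_rfl) (fun _ _ => hlt ▸ seqsCode_mem_upUp) hs
      fun ρ hρ hsρ => exists_append_of_finite htri hinf (fun c hc => by
        by_contra hinf'
        exact absurd (hstuck σ (τ ++ [c]) ⟨hs.append_right hc, hinf'⟩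
          ⟨List.prefix_rfl, List.prefix_append _ _⟩) (by simp)) hρ hsρ
    exact ⟨f, Or.inl (forall_lt_of_pairwise fun n => (hf n).1.1), h⟩

/-! ### The Turing ideal -/

/-- A relation that is not a linear order needs no solution; joining `O` with itself then keeps the
left projection uniform over all stages. -/
theorem DepHyperimmune.exists_step {A O : Set ℕ} (hO : DepHyperimmune A O) (l : OpCode) :
    ∃ O', DepHyperimmune A O' ∧ OpCode.left.eval O' = O ∧
      ∀ lt : ℕ → ℕ → Prop, factLT (l.eval O) = lt → (∀ a b c, lt a b → lt b c → lt a c) →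
        (∀ a b, lt a b ∨ a = b ∨ lt b a) →
        ∃ f : ℕ → ℕ, ((∀ i j, i < j → lt (f i) (f j)) ∨ ∀ i j, i < j → lt (f j) (f i)) ∧
          OpCode.right.eval O' = facts (graphSet f) := by
  by_cases h : (∀ a b c, factLT (l.eval O) a b → factLT (l.eval O) b c → factLT (l.eval O) a c) ∧
      ∀ a b, factLT (l.eval O) a b ∨ a = b ∨ factLT (l.eval O) b a
  · obtain ⟨f, hf, hfO⟩ := hO.exists_monotone_seq l rfl h.1 h.2
    exact ⟨_, hfO, by simp, fun lt hlt _ _ => ⟨f, hlt ▸ hf, by simp⟩⟩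
  · exact ⟨_, hO.eval (.join .id .id), by simp [OpCode.eval],
      fun lt hlt h1 h2 => (h (hlt ▸ ⟨h1, h2⟩)).elim⟩

/-- The sets of which all facts are enumerated from some member of a sequence of sets of facts. -/
def enumIdeal (O : ℕ → Set ℕ) : Set (Set ℕ) := {Y | ∃ n, ∃ c : OpCode, c.eval (O n) = facts Y}

/-- The code of the iterated left projection. -/
def OpCode.leftIter : ℕ → OpCode
  | 0 => .id
  | d + 1 => .comp (leftIter d) .left

theorem compl_turingJoin (A B : Set ℕ) : (turingJoin A B)ᶜ = turingJoin Aᶜ Bᶜ :=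
  eq_turingJoin_iff.2 (by simp)

section Ideal

variable {O : ℕ → Set ℕ}

theorem OpCode.eval_leftIter (hO : ∀ n, OpCode.left.eval (O (n + 1)) = O n) (n d : ℕ) :
    (OpCode.leftIter d).eval (O (n + d)) = O n := by
  induction d with
  | zero => rfl
  | succ d ih =>
    rw [OpCode.leftIter, OpCode.eval, ← Nat.add_assoc, hO, ih]

theorem enumIdeal_exists_code {Y : Set ℕ} (hO : ∀ n, OpCode.left.eval (O (n + 1)) = O n) {n m : ℕ}
    {c : OpCode} (hc : c.eval (O n) = facts Y) (h : n ≤ m) :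
    ∃ d : OpCode, d.eval (O m) = facts Y := by
  obtain ⟨k, rfl⟩ := Nat.exists_eq_add_of_le h
  exact ⟨.comp c (.leftIter k), by rw [OpCode.eval, OpCode.eval_leftIter hO, hc]⟩

theorem enumIdeal_of_eval {Y Z : Set ℕ} (hY : Y ∈ enumIdeal O) {c : OpCode}
    (h : c.eval (facts Y) = facts Z) : Z ∈ enumIdeal O := by
  obtain ⟨n, d, hd⟩ := hY
  exact ⟨n, .comp c d, by rw [OpCode.eval, hd, h]⟩

/-- Both sources are available at a common later stage, where the enumerations of `Z` and `Zᶜ`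
combine to one of `facts Z`. Closure under join and `Δ⁰₁` comprehension both come from this. -/
theorem enumIdeal_of_enum {Y Y' Z : Set ℕ} (hO : ∀ n, OpCode.left.eval (O (n + 1)) = O n)
    (hY : Y ∈ enumIdeal O) (hY' : Y' ∈ enumIdeal O) {c c' : OpCode}
    (h : c.eval (turingJoin (facts Y) (facts Y')) = Z)
    (h' : c'.eval (turingJoin (facts Y) (facts Y')) = Zᶜ) : Z ∈ enumIdeal O := by
  obtain ⟨n, d, hd⟩ := hY
  obtain ⟨n', d', hd'⟩ := hY'
  obtain ⟨e, he⟩ := enumIdeal_exists_code hO hd (le_max_left n n')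
  obtain ⟨e', he'⟩ := enumIdeal_exists_code hO hd' (le_max_right n n')
  refine ⟨max n n', .comp (.join c c') (.join e e'), ?_⟩
  simp only [OpCode.eval, he, he', h, h']
  rfl

theorem isTuringIdeal_enumIdeal (hO : ∀ n, OpCode.left.eval (O (n + 1)) = O n)
    (hne : (enumIdeal O).Nonempty) : IsTuringIdeal (enumIdeal O) where
  nonempty := hne
  downward A B hB hAB := by
    obtain ⟨c, hc⟩ := exists_oracleCode (RecursiveIn.iff_nat.1 hAB)
    refine enumIdeal_of_eval hB (c := .turing c) ?_
    change turingJoin _ _ = turingJoin A Aᶜ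
    congr 1 <;> ext n <;> by_cases hn : n ∈ A <;> simp [hc, charFun, hn]
  join A B hA hB := by
    refine enumIdeal_of_enum hO hA hB
      (c := .join (.comp .left .left) (.comp .left .right))
      (c' := .join (.comp .right .left) (.comp .right .right)) ?_ ?_
    · simp [OpCode.eval]
    · rw [compl_turingJoin]
      simp [OpCode.eval]
      rfl

/-- Finitely many members of a Turing ideal are the columns of a single member. -/
theorem IsTuringIdeal.exists_columns {I : Set (Set ℕ)} (hI : IsTuringIdeal I) {k : ℕ}
    (S : Fin k → Set ℕ) (hS : ∀ i, S i ∈ I) : ∃ Y ∈ I, (fun i : Fin k => columnSet Y i) = S := by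
  induction k with
  | zero =>
    obtain ⟨Y, hY⟩ := hI.nonempty
    exact ⟨Y, hY, funext fun i => i.elim0⟩
  | succ k ih =>
    obtain ⟨Y, hY, h⟩ := ih (fun i => S i.succ) fun i => hS _
    refine ⟨turingJoin (S 0) Y, hI.join _ _ (hS 0) hY, funext fun i => ?_⟩
    refine Fin.cases ?_ (fun i => ?_) i
    · ext x
      simp [columnSet, column]
    · rw [← congrFun h i]
      ext x
      simp [columnSet, column]

theorem exists_enum_of_isSigma01 {I : Set (Set ℕ)} (hI : IsTuringIdeal I) {P : ℕ → Prop}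
    (hP : (omegaModel I).IsSigma01 P) : ∃ Y ∈ I, ∃ c : OpCode, c.eval (facts Y) = {n | P n} := by
  obtain ⟨k, p, θ, S, e, hS, hP⟩ := hP
  obtain ⟨Y, hY, rfl⟩ := hI.exists_columns S hS
  refine ⟨Y, hY, .sigma ⟨k, p, θ, e⟩, Set.ext fun n => ?_⟩
  exact ParamFormula.mem_op_facts.trans (hP n).symm

theorem isSigma01_not_of_isPi01 {𝓜 : L2Structure} {P : 𝓜.carrier → Prop} (hP : 𝓜.IsPi01 P) :
    𝓜.IsSigma01 fun n => ¬ P n := by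
  obtain ⟨k, p, θ, S, e, hS, hP⟩ := hP
  exact ⟨k, p, .not θ, S, e, hS, fun n => (not_congr (hP n)).trans not_forall⟩

theorem modelsRCA0_enumIdeal (hO : ∀ n, OpCode.left.eval (O (n + 1)) = O n)
    (hne : (enumIdeal O).Nonempty) : (omegaModel (enumIdeal O)).ModelsRCA0 where
  succ_ne_zero := Nat.succ_ne_zero
  succ_inj _ _ := Nat.succ.inj
  add_zero _ := rfl
  add_succ _ _ := rfl
  mul_zero _ := rfl
  mul_succ _ _ := rfl
  not_lt_zero := Nat.not_lt_zero
  lt_succ _ _ := Nat.lt_succ_iff_lt_or_eq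
  sigma_induction P _ h0 hs n := Nat.rec h0 hs n
  delta_comprehension P hS hP := by
    have hI := isTuringIdeal_enumIdeal hO hne
    obtain ⟨Y, hY, c, hc⟩ := exists_enum_of_isSigma01 hI hS
    obtain ⟨Y', hY', c', hc'⟩ := exists_enum_of_isSigma01 hI (isSigma01_not_of_isPi01 hP)
    refine enumIdeal_of_enum hO hY hY' (c := .comp c .left) (c' := .comp c' .right) ?_ ?_
    · rw [OpCode.eval, OpCode.eval_left_turingJoin, hc]
    · rw [OpCode.eval, OpCode.eval_right_turingJoin, hc']
      rfl

end Ideal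

/-! ### `ADS` and `SCAC` in the model -/

section Model

open L2Structure StagedPoset

variable {I : Set (Set ℕ)}

theorem isFunction_graphSet (f : ℕ → ℕ) : IsFunction (𝓜 := omegaModel I) (graphSet f) :=
  fun n => ⟨f n, npair_mem_graphSet.2 rfl, fun _ h => (npair_mem_graphSet.1 h).symm⟩

theorem isAscendingSeq_graphSet {L : Set ℕ} {f : ℕ → ℕ}
    (h : ∀ i j, i < j → npair (f i) (f j) ∈ L) :
    IsAscendingSeq (𝓜 := omegaModel I) L (graphSet f) := by
  refine ⟨isFunction_graphSet f, fun n m a b hnm ha hb => ?_⟩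
  obtain rfl := npair_mem_graphSet.1 ha
  obtain rfl := npair_mem_graphSet.1 hb
  exact h n m hnm

theorem isDescendingSeq_graphSet {L : Set ℕ} {f : ℕ → ℕ}
    (h : ∀ i j, i < j → npair (f j) (f i) ∈ L) :
    IsDescendingSeq (𝓜 := omegaModel I) L (graphSet f) := by
  refine ⟨isFunction_graphSet f, fun n m a b hnm ha hb => ?_⟩
  obtain rfl := npair_mem_graphSet.1 ha
  obtain rfl := npair_mem_graphSet.1 hb
  exact h n m hnm

theorem not_scac_of_depHyperimmune {r : ℕ → ℕ → Prop} {A : Set ℕ} (hrefl : ∀ a, r a a)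
    (htrans : ∀ a b c, r a b → r b c → r a c) (hle : ∀ a b, r a b → a ≤ b)
    (hlim : ∀ a, ∃ n, ∀ b, n ≤ b → (r a b ↔ a ∈ A)) (hr : relSet r ∈ I)
    (hI : ∀ H ∈ I, DepHyperimmune A (facts H)) : ¬ (omegaModel I).SCAC := by
  intro hscac
  have hrel : ∀ a b : ℕ, Rel (𝓜 := omegaModel I) (relSet r) a b ↔ r a b :=
    fun a b => npair_mem_relSet
  have hposet : IsPoset (𝓜 := omegaModel I) (relSet r) :=
    ⟨fun a => (hrel a a).2 (hrefl a),
      fun a b hab hba => le_antisymm (hle a b ((hrel a b).1 hab)) (hle b a ((hrel b a).1 hba)),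
      fun a b c hab hbc => (hrel a c).2 (htrans a b c ((hrel a b).1 hab) ((hrel b c).1 hbc))⟩
  have hcomp : ∀ a : ℕ, ∃ n, ∀ b, n < b →
      (Comparable (𝓜 := omegaModel I) (relSet r) a b ↔ a ∈ A) := by
    intro a
    obtain ⟨n, hn⟩ := hlim a
    -- Past `a` the relation `r b a` is impossible, so comparability with `b` reduces to `r a b`.
    refine ⟨max n a, fun b hb => ?_⟩
    unfold Comparable
    rw [hrel, hrel, ← hn b (by lia)]
    have := hle b a
    exact or_iff_left fun h => by have := this h; lia
  have hstable : IsStable (𝓜 := omegaModel I) (relSet r) := by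
    refine Or.inl (Set.eq_univ_of_forall fun a => ?_)
    by_cases ha : a ∈ A
    · obtain ⟨n, hn⟩ := hlim a
      exact Or.inl ⟨n, fun b hb => (hrel a b).2 ((hn b (le_of_lt hb)).2 ha)⟩
    · obtain ⟨n, hn⟩ := hcomp a
      exact Or.inr ⟨n, fun b hb h => ha ((hn b hb).1 h)⟩
  obtain ⟨H, hH, hinf, hchain⟩ := hscac _ hr hposet hstable
  obtain ⟨h1, h2⟩ := (hI H hH).not_infinite_subset hinf
  rcases hchain with h | h
  · refine h1 fun a ha => ?_
    obtain ⟨n, hn⟩ := hcomp a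
    obtain ⟨b, hb, hnb⟩ := hinf n
    exact (hn b hnb).1 (h a ha b hb)
  · refine h2 fun a ha haA => ?_
    obtain ⟨n, hn⟩ := hcomp a
    obtain ⟨b, hb, hnb⟩ := hinf (max n a)
    replace hnb : max n a < b := hnb
    exact h a ha b hb (by lia) ((hn b (by lia)).2 haA)

end Model

theorem L2Structure.CAC.scac {𝓜 : L2Structure} (h : 𝓜.CAC) : 𝓜.SCAC :=
  fun X hX hP _ => h X hX hP

open L2Structure StagedPoset in
/-- There is a model of `RCA₀` and `ADS` given by a Turing ideal in which `SCAC` fails. -/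
theorem exists_ideal_ads_not_scac : ∃ I : Set (Set ℕ), IsTuringIdeal I ∧
    (omegaModel I).ModelsRCA0 ∧ (omegaModel I).ADS ∧ ¬ (omegaModel I).SCAC := by
  obtain ⟨r, A, hrefl, htrans, hle, hlim, hA⟩ := exists_generic_poset
  have : Nonempty OpCode := ⟨.id⟩
  obtain ⟨e, he⟩ := exists_surjective_nat OpCode
  -- Stage `s = Nat.pair n j` treats the `j`-th operator applied to `O n`. Since `n ≤ s`, that
  -- oracle is recovered from `O s` by `s - n` left projections.
  let T : ℕ → OpCode := fun s => .comp (e s.unpair.2) (.leftIter (s - s.unpair.1))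
  obtain ⟨O, h0, hO⟩ := exists_seq_of_step (⟨_, hA⟩ : {O // DepHyperimmune A O})
    (r := fun n x y => OpCode.left.eval y.1 = x.1 ∧
      ∀ lt : ℕ → ℕ → Prop, factLT ((T n).eval x.1) = lt →
        (∀ a b c, lt a b → lt b c → lt a c) →
        (∀ a b, lt a b ∨ a = b ∨ lt b a) →
        ∃ f : ℕ → ℕ, ((∀ i j, i < j → lt (f i) (f j)) ∨ ∀ i j, i < j → lt (f j) (f i)) ∧
          OpCode.right.eval y.1 = facts (graphSet f))
    fun n x => by
      obtain ⟨O', h, h'⟩ := x.2.exists_step (T n)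
      exact ⟨⟨O', h⟩, h'⟩
  have hleft : ∀ n, OpCode.left.eval (O (n + 1)).1 = (O n).1 := fun n => (hO n).1
  have hr : relSet r ∈ enumIdeal fun n => (O n).1 := ⟨0, .id, congrArg Subtype.val h0⟩
  refine ⟨enumIdeal fun n => (O n).1, isTuringIdeal_enumIdeal hleft ⟨_, hr⟩,
    modelsRCA0_enumIdeal hleft ⟨_, hr⟩, fun L hL hlin => ?_,
    not_scac_of_depHyperimmune hrefl htrans hle hlim hr fun H ⟨n, c, hc⟩ => hc ▸ (O n).2.eval c⟩
  obtain ⟨n, c, hc⟩ := hL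
  obtain ⟨j, rfl⟩ := he c
  set s := Nat.pair n j with hs
  have hn : n ≤ s := Nat.left_le_pair n j
  have hT : (T s).eval (O s).1 = facts L := by
    have h := OpCode.eval_leftIter (O := fun n => (O n).1) hleft n (s - n)
    rw [Nat.add_sub_cancel' hn] at h
    change (e s.unpair.2).eval ((OpCode.leftIter (s - s.unpair.1)).eval (O s).1) = facts L
    rw [show s.unpair = (n, j) from Nat.unpair_pair n j, ← hc]
    exact congrArg (e j).eval h
  have hlt : factLT ((T s).eval (O s).1) = fun a b => npair a b ∈ L := by
    funext a b
    simp [hT, factLT]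
  obtain ⟨f, hf, hF⟩ := (hO s).2 _ hlt hlin.2.1 hlin.2.2
  exact ⟨graphSet f, ⟨s + 1, .right, hF⟩,
    hf.imp isAscendingSeq_graphSet isDescendingSeq_graphSet⟩

theorem theorem1p1 :
    (∃ I : Set (Set ℕ), IsTuringIdeal I ∧
      (omegaModel I).ADS ∧ ¬ (omegaModel I).SCAC) ∧
    ¬ ImpliesOverRCA0 L2Structure.ADS L2Structure.SCAC ∧
    ¬ ImpliesOverRCA0 L2Structure.ADS L2Structure.CAC := by
  obtain ⟨I, hI, hrca, hads, hscac⟩ := exists_ideal_ads_not_scac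
  exact ⟨⟨I, hI, hads, hscac⟩, fun h => hscac (h _ hrca hads),
    fun h => hscac (h _ hrca hads).scac⟩
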